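/- Let $K$ be an algebraically closed field of characteristic $0$, $V$ a finite-dimensional $K$-vector space, $S$ the algebra of polynomial functions on $V$ (the symmetric algebra of $V^*$, with $\mathrm{GL}(V)$ acting by $(gf)(v)=f(g^{-1}v)$), and $G\subset\mathrm{GL}(V)$ a finite group generated by (pseudo)reflections. *Fake degrees.* For any finite group $G$ generated by reflections in such a space $V$, let $S_G=\bigoplus_n (S_G)_n$ be its graded algebra of coinvariants, i.e. the quotient of $S$ by the ideal generated by the $G$-invariants with no constant term. If a group $A\subset \mathrm{GL}(V)$ contains and normalises $G$, $\gamma\in A$, and $M$ is a finite-dimensional $A$-module over $K$, the fake $\gamma$-degree of $M$ is the polynomial $$F_{M,\gamma}(t)=\sum_{n\ge 0}\operatorname{Trace}\bigl(\gamma,\,((S_G)_n\otimes M^*)^G\bigr)\,t^n .$$ *Reflection quotients.* Let $L$ be a normal subgroup of $G$, let $S^L_+$ be the space of $L$-invariant elements of $S$ with no constant term, and let $E^*\subset S^L_+$ be a graded complement of $(S^L_+)^2$ in $S^L_+$ that is stable under the normaliser of $L$ in $\mathrm{GL}(V)$. Let $E=\bigoplus_i E_i$ be the graded dual of $E^*$,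 where $E_i$ is the dual of the component of $E^*$ of degree $i$. Assume that the image $\bar G$ of $G$ in $\mathrm{GL}(E)$ is generated by (pseudo)reflections. Let $\Gamma$ be a subgroup of $\mathrm{GL}(V)$ that normalises both $G$ and $L$, and let $\bar G_i$, $\bar\Gamma_i$ be the images of $G$, $\Gamma$ in $\mathrm{GL}(E_i)$. **Proposition.** Let $D$ be a finite set of non-negative integers that contains every $i$ with $E_i\ne 0$. For each $i\in D$ let $\bar M_i$ be a finite-dimensional $\langle\bar G_i,\bar\Gamma_i\rangle$-module, and let $M=\bigotimes_{i\in D}\bar M_i$, regarded as a $\langle G,\Gamma\rangle$-module through the maps $\langle G,\Gamma\rangle\to\langle\bar G_i,\bar\Gamma_i\rangle$. Then for every $\gamma\in\Gamma$, with images $\bar\gamma_i\in\bar\Gamma_i$, $$F_{M,\gamma}(t)=\prod_{i\in D}F_{\bar M_i,\bar\gamma_i}(t^i),$$ where $F_{M,\gamma}$ is formed with respect to $(V,G)$ and $F_{\bar M_i,\bar\gamma_i}$ with respect to $(E_i,\bar G_i)$, the linear forms on $E_i$ having degree $1$. -/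

import Mathlib

open Polynomial TensorProduct

namespace ReflectionCoset

noncomputable section

universe u v w

section Reflections

variable {K : Type u} [Field K] {V : Type v} [AddCommGroup V] [Module K V]

/-- A (pseudo)reflection: an automorphism of finite order whose fixed space is a hyperplane. -/
def IsPseudoreflection (g : V ≃ₗ[K] V) : Prop :=
  IsOfFinOrder g ∧ Module.finrank K (V ⧸ LinearMap.ker (g.toLinearMap - LinearMap.id)) = 1

/-- A finite subgroup of `GL(V)` that is generated by the (pseudo)reflections it contains. -/
def IsReflectionGroup (G : Subgroup (V ≃ₗ[K] V)) : Prop :=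
  Finite G ∧ Subgroup.closure {g | g ∈ G ∧ IsPseudoreflection g} = G

end Reflections

section PolynomialFunctions

variable (K : Type u) [Field K] (V : Type v) [AddCommGroup V] [Module K V]

/-- The algebra `S` of polynomial functions on `V`, i.e. the symmetric algebra of `V^*`. -/
abbrev PolyFun : Type (max u v) := SymmetricAlgebra K (Module.Dual K V)

variable {K V}

/-- The action of `g ∈ GL(V)` on polynomial functions: on linear forms, `φ ↦ φ ∘ g⁻¹`. -/
def polyAct (g : V ≃ₗ[K] V) : PolyFun K V →ₐ[K] PolyFun K V :=
  SymmetricAlgebra.lift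
    (SymmetricAlgebra.ι K (Module.Dual K V) ∘ₗ Module.Dual.transpose (g⁻¹ : V ≃ₗ[K] V).toLinearMap)

lemma polyAct_ι (g : V ≃ₗ[K] V) (φ : Module.Dual K V) :
    polyAct g (SymmetricAlgebra.ι K _ φ) =
      SymmetricAlgebra.ι K _ (φ ∘ₗ (g⁻¹ : V ≃ₗ[K] V).toLinearMap) := by
  simp [polyAct, Module.Dual.transpose_apply]

lemma polyAct_one : polyAct (1 : V ≃ₗ[K] V) = AlgHom.id K (PolyFun K V) := by
  apply SymmetricAlgebra.algHom_ext
  refine LinearMap.ext fun φ => ?_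
  change polyAct (1 : V ≃ₗ[K] V) (SymmetricAlgebra.ι K _ φ) = SymmetricAlgebra.ι K _ φ
  rw [polyAct_ι]
  rfl

lemma polyAct_mul (g h : V ≃ₗ[K] V) : polyAct (g * h) = (polyAct g).comp (polyAct h) := by
  apply SymmetricAlgebra.algHom_ext
  refine LinearMap.ext fun φ => ?_
  change polyAct (g * h) (SymmetricAlgebra.ι K _ φ) = polyAct g (polyAct h (SymmetricAlgebra.ι K _ φ))
  rw [polyAct_ι, polyAct_ι, polyAct_ι, mul_inv_rev]
  rfl

variable (K V) in
/-- The representation of `GL(V)` on the polynomial functions on `V`. -/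
def polyRep : Representation K (V ≃ₗ[K] V) (PolyFun K V) where
  toFun g := (polyAct g).toLinearMap
  map_one' := by rw [polyAct_one]; rfl
  map_mul' g h := by rw [polyAct_mul]; rfl

variable (K V) in
/-- The space `S_n` of homogeneous polynomial functions of degree `n`. -/
def homog (n : ℕ) : Submodule K (PolyFun K V) :=
  LinearMap.range (SymmetricAlgebra.ι K (Module.Dual K V)) ^ n

variable (K V) in
/-- The polynomial functions with no constant term. -/
def posPart : Submodule K (PolyFun K V) :=
  LinearMap.ker (SymmetricAlgebra.algebraMapInv (R := K) (M := Module.Dual K V)).toLinearMap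

/-- The space `S^H_+` of `H`-invariant polynomial functions with no constant term. -/
def invariantsPos (H : Subgroup (V ≃ₗ[K] V)) : Submodule K (PolyFun K V) :=
  Representation.invariants ((polyRep K V).comp H.subtype) ⊓ posPart K V

lemma polyAct_mem_homog (g : V ≃ₗ[K] V) (n : ℕ) {f : PolyFun K V} (hf : f ∈ homog K V n) :
    polyAct g f ∈ homog K V n := by
  have h : (homog K V n).map (polyAct g).toLinearMap ≤ homog K V n := by
    unfold homog
    rw [Submodule.map_pow]
    refine pow_le_pow_left' ?_ n
    rintro _ ⟨_, ⟨φ, rfl⟩, rfl⟩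
    rw [AlgHom.toLinearMap_apply, polyAct_ι]
    exact ⟨_, rfl⟩
  exact h ⟨f, hf, rfl⟩

lemma polyAct_mem_posPart (g : V ≃ₗ[K] V) {f : PolyFun K V} (hf : f ∈ posPart K V) :
    polyAct g f ∈ posPart K V := by
  have h : (SymmetricAlgebra.algebraMapInv (R := K) (M := Module.Dual K V)).comp (polyAct g) =
      SymmetricAlgebra.algebraMapInv := by
    apply SymmetricAlgebra.algHom_ext
    refine LinearMap.ext fun φ => ?_
    change SymmetricAlgebra.algebraMapInv (polyAct g (SymmetricAlgebra.ι K _ φ)) =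
      SymmetricAlgebra.algebraMapInv (SymmetricAlgebra.ι K _ φ)
    rw [polyAct_ι, SymmetricAlgebra.algebraMapInv_ι, SymmetricAlgebra.algebraMapInv_ι]
  have h2 := DFunLike.congr_fun h f
  simp only [AlgHom.comp_apply] at h2
  unfold posPart at hf ⊢
  rw [LinearMap.mem_ker, AlgHom.toLinearMap_apply] at hf ⊢
  rw [h2, hf]

lemma polyAct_mem_invariantsPos {H : Subgroup (V ≃ₗ[K] V)} {g : V ≃ₗ[K] V}
    (hg : g ∈ Subgroup.normalizer (H : Set (V ≃ₗ[K] V))) {f : PolyFun K V}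
    (hf : f ∈ invariantsPos H) : polyAct g f ∈ invariantsPos H := by
  refine ⟨fun x => ?_, polyAct_mem_posPart g hf.2⟩
  have hx : g⁻¹ * (x : V ≃ₗ[K] V) * g ∈ H := by
    have := (Subgroup.mem_normalizer_iff.1 (inv_mem hg) (x : V ≃ₗ[K] V)).1 x.2
    simpa using this
  have h1 : polyAct (g⁻¹ * (x : V ≃ₗ[K] V) * g) f = f := hf.1 ⟨_, hx⟩
  change polyAct (x : V ≃ₗ[K] V) (polyAct g f) = polyAct g f
  conv_rhs => rw [← h1]
  rw [← AlgHom.comp_apply, ← AlgHom.comp_apply, ← polyAct_mul, ← polyAct_mul]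
  congr 2
  group

end PolynomialFunctions

section Coinvariants

variable {K : Type u} [Field K] {V : Type v} [AddCommGroup V] [Module K V]

/-- The ideal of `S` generated by the `G`-invariants with no constant term. -/
def coinvariantIdeal (G : Subgroup (V ≃ₗ[K] V)) : Ideal (PolyFun K V) :=
  Ideal.span (invariantsPos G : Set (PolyFun K V))

/-- The algebra `S_G` of coinvariants of `G`. -/
abbrev Coinvariants (G : Subgroup (V ≃ₗ[K] V)) : Type (max u v) :=
  PolyFun K V ⧸ coinvariantIdeal G

/-- The homogeneous component `(S_G)_n` of degree `n` of the coinvariant algebra. -/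
def coinvariantsHomog (G : Subgroup (V ≃ₗ[K] V)) (n : ℕ) : Submodule K (Coinvariants G) :=
  (homog K V n).map (Ideal.Quotient.mkₐ K (coinvariantIdeal G)).toLinearMap

lemma coinvariantIdeal_le_comap {G : Subgroup (V ≃ₗ[K] V)} {g : V ≃ₗ[K] V}
    (hg : g ∈ Subgroup.normalizer (G : Set (V ≃ₗ[K] V))) :
    coinvariantIdeal G ≤ (coinvariantIdeal G).comap (polyAct g) := by
  unfold coinvariantIdeal
  rw [Ideal.span_le]
  intro f hf
  exact Ideal.subset_span (polyAct_mem_invariantsPos hg hf)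

variable {G A : Subgroup (V ≃ₗ[K] V)}

/-- The automorphism of `S_G` induced by an element `g` of `GL(V)` that normalises `G`. -/
def coinvariantsAct {g : V ≃ₗ[K] V} (hg : g ∈ Subgroup.normalizer (G : Set (V ≃ₗ[K] V))) :
    Coinvariants G →ₐ[K] Coinvariants G :=
  Ideal.quotientMapₐ (coinvariantIdeal G) (polyAct g) (coinvariantIdeal_le_comap hg)

lemma coinvariantsAct_mk {g : V ≃ₗ[K] V} (hg : g ∈ Subgroup.normalizer (G : Set (V ≃ₗ[K] V)))
    (f : PolyFun K V) : coinvariantsAct hg (Ideal.Quotient.mk (coinvariantIdeal G) f) =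
      Ideal.Quotient.mk (coinvariantIdeal G) (polyAct g f) :=
  rfl

/-- The action on `S_G` of a group `A` that normalises `G`. -/
def coinvariantsRep (hA : A ≤ Subgroup.normalizer (G : Set (V ≃ₗ[K] V))) :
    Representation K A (Coinvariants G) where
  toFun a := (coinvariantsAct (hA a.2)).toLinearMap
  map_one' := by
    refine LinearMap.ext fun x => ?_
    obtain ⟨f, rfl⟩ := Ideal.Quotient.mk_surjective x
    rw [AlgHom.toLinearMap_apply, coinvariantsAct_mk, OneMemClass.coe_one, polyAct_one]
    rfl
  map_mul' a b := by
    refine LinearMap.ext fun x => ?_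
    obtain ⟨f, rfl⟩ := Ideal.Quotient.mk_surjective x
    rw [Module.End.mul_apply, AlgHom.toLinearMap_apply, AlgHom.toLinearMap_apply,
      AlgHom.toLinearMap_apply, coinvariantsAct_mk, coinvariantsAct_mk, coinvariantsAct_mk,
      Subgroup.coe_mul, polyAct_mul]
    rfl

lemma coinvariantsHomog_le_comap (hA : A ≤ Subgroup.normalizer (G : Set (V ≃ₗ[K] V))) (n : ℕ)
    (a : A) : coinvariantsHomog G n ≤ (coinvariantsHomog G n).comap (coinvariantsRep hA a) := by
  rintro _ ⟨f, hf, rfl⟩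
  refine ⟨polyAct (a : V ≃ₗ[K] V) f, polyAct_mem_homog _ n hf, ?_⟩
  exact (coinvariantsAct_mk (hA a.2) f).symm

/-- The action of `A` on the homogeneous component `(S_G)_n`. -/
def coinvariantsHomogRep (hA : A ≤ Subgroup.normalizer (G : Set (V ≃ₗ[K] V))) (n : ℕ) :
    Representation K A (coinvariantsHomog G n) :=
  (coinvariantsRep hA).subrepresentation (coinvariantsHomog G n) (coinvariantsHomog_le_comap hA n)

variable {M : Type w} [AddCommGroup M] [Module K M]

/-- The trace of `γ` on `((S_G)_n ⊗ M^*)^G`, where `M` is a module for a group `A` that contains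
and normalises `G`, and `γ ∈ A`. -/
def fakeDegreeCoeff (hGA : G ≤ A) (hA : A ≤ Subgroup.normalizer (G : Set (V ≃ₗ[K] V)))
    (ρ : Representation K A M) (γ : A) (n : ℕ) : K :=
  haveI : (G.subgroupOf A).Normal := (Subgroup.normal_subgroupOf_iff_le_normalizer hGA).2 hA
  LinearMap.trace K _
    (Representation.toInvariants (V := coinvariantsHomog G n ⊗[K] Module.Dual K M)
      ((coinvariantsHomogRep hA n).tprod ρ.dual) (G.subgroupOf A) γ)

/-- The fake `γ`-degree `F_{M,γ}(t) = ∑_n Trace(γ, ((S_G)_n ⊗ M^*)^G) t^n`. -/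
def fakeDegree (hGA : G ≤ A) (hA : A ≤ Subgroup.normalizer (G : Set (V ≃ₗ[K] V)))
    (ρ : Representation K A M) (γ : A) : K[X] :=
  ∑ᶠ n : ℕ, Polynomial.monomial n (fakeDegreeCoeff hGA hA ρ γ n)

/-- For `G` finite the coinvariant algebra vanishes in large degrees, so that the sum that defines
the fake degree is finite. -/
lemma exists_coinvariantsHomog_eq_bot [FiniteDimensional K V] (G : Subgroup (V ≃ₗ[K] V)) [Finite G] :
    ∃ N, ∀ n, N ≤ n → coinvariantsHomog G n = ⊥ := by
  classical
  have := Fintype.ofFinite G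
  let J : Ideal (PolyFun K V) :=
    Ideal.span (LinearMap.range (SymmetricAlgebra.ι K (Module.Dual K V)) : Set (PolyFun K V))
  have hJfg : J.FG := by
    let b := Module.finBasis K (Module.Dual K V)
    refine ⟨Finset.univ.image fun i => SymmetricAlgebra.ι K (Module.Dual K V) (b i), ?_⟩
    apply le_antisymm
    · refine Ideal.span_mono ?_
      intro x hx
      simp only [Finset.coe_image, Finset.coe_univ, Set.image_univ, Set.mem_range] at hx
      obtain ⟨i, rfl⟩ := hx
      exact ⟨_, rfl⟩
    · refine Ideal.span_le.2 ?_
      rintro _ ⟨φ, rfl⟩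
      rw [← b.sum_repr φ, map_sum]
      refine Ideal.sum_mem _ fun i _ => ?_
      rw [map_smul, Algebra.smul_def]
      refine Ideal.mul_mem_left _ _ (Ideal.subset_span ?_)
      simp
  have hJrad : J ≤ (coinvariantIdeal G).radical := by
    refine Ideal.span_le.2 ?_
    rintro _ ⟨φ, rfl⟩
    set f := SymmetricAlgebra.ι K (Module.Dual K V) φ with hf
    let P : (PolyFun K V)[X] := ∏ g : G, (X - C (polyAct (g : V ≃ₗ[K] V) f))
    have hmonic : ∀ g ∈ (Finset.univ : Finset G),
        (X - C (polyAct (g : V ≃ₗ[K] V) f)).Monic := fun g _ => monic_X_sub_C _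
    have hPmonic : P.Monic := monic_prod_of_monic _ _ hmonic
    have hPdeg : P.natDegree = Fintype.card G := by
      simp [P, natDegree_prod_of_monic _ _ hmonic]
    have hPeval : P.eval f = 0 := by
      rw [eval_prod]
      refine Finset.prod_eq_zero (Finset.mem_univ (1 : G)) ?_
      simp [polyAct_one]
    have hPinv : ∀ h : G, P.map (polyAct (h : V ≃ₗ[K] V)).toRingHom = P := by
      intro h
      simp only [P, Polynomial.map_prod, Polynomial.map_sub, map_X, map_C]
      refine Fintype.prod_equiv (Equiv.mulLeft h) _ _ fun g => ?_
      congr 2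
      change polyAct (h : V ≃ₗ[K] V) (polyAct (g : V ≃ₗ[K] V) f) = _
      rw [Equiv.coe_mulLeft, Subgroup.coe_mul, polyAct_mul]
      rfl
    have hPaug : P.map (SymmetricAlgebra.algebraMapInv (R := K) (M := Module.Dual K V)).toRingHom =
        X ^ Fintype.card G := by
      simp only [P, Polynomial.map_prod, Polynomial.map_sub, map_X, map_C]
      rw [Finset.prod_congr rfl (g := fun _ => X), Finset.prod_const, Finset.card_univ]
      intro g _
      have : (SymmetricAlgebra.algebraMapInv (R := K) (M := Module.Dual K V)).toRingHom
          (polyAct (g : V ≃ₗ[K] V) f) = 0 := by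
        rw [hf, polyAct_ι]
        exact SymmetricAlgebra.algebraMapInv_ι _
      rw [this, map_zero, sub_zero]
    have hcoeff : ∀ k, k < Fintype.card G → P.coeff k ∈ coinvariantIdeal G := by
      intro k hk
      refine Ideal.subset_span ⟨fun h => ?_, ?_⟩
      · have := congrArg (fun Q => Polynomial.coeff Q k) (hPinv h)
        simp only [coeff_map] at this
        exact this
      · have := congrArg (fun Q => Polynomial.coeff Q k) hPaug
        simp only [coeff_map, coeff_X_pow, hk.ne, if_false] at this
        exact this
    refine ⟨Fintype.card G, ?_⟩
    have h0 := hPeval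
    rw [eval_eq_sum_range, hPdeg, Finset.sum_range_succ] at h0
    have hlead : P.coeff (Fintype.card G) = 1 := by rw [← hPdeg]; exact hPmonic
    rw [hlead, one_mul] at h0
    rw [eq_neg_of_add_eq_zero_right h0]
    refine neg_mem (Ideal.sum_mem _ fun k hk => ?_)
    exact Ideal.mul_mem_right _ _ (hcoeff k (Finset.mem_range.1 hk))
  obtain ⟨N, hN⟩ := Ideal.exists_pow_le_of_le_radical_of_fg hJrad hJfg
  refine ⟨N, fun n hn => ?_⟩
  have hle : ∀ m, homog K V m ≤ (J ^ m).restrictScalars K := by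
    intro m
    induction m with
    | zero => intro x _; simp
    | succ m ih =>
      unfold homog at ih ⊢
      rw [pow_succ, pow_succ, Submodule.mul_le]
      intro a ha b hb
      exact Ideal.mul_mem_mul (ih ha) (Ideal.subset_span hb)
  rw [eq_bot_iff]
  rintro _ ⟨f, hf, rfl⟩
  exact Ideal.Quotient.eq_zero_iff_mem.2 (hN (Ideal.pow_le_pow_right hn (hle n hf)))

lemma trace_eq_zero_of_subsingleton {W : Type w} [AddCommMonoid W] [Module K W]
    (hW : Subsingleton W) (f : W →ₗ[K] W) : LinearMap.trace K W f = 0 := by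
  have h : f = 0 := LinearMap.ext fun x => Subsingleton.elim _ _
  rw [h, map_zero]

lemma coeff_fakeDegree [FiniteDimensional K V] [Finite G] (hGA : G ≤ A)
    (hA : A ≤ Subgroup.normalizer (G : Set (V ≃ₗ[K] V)))
    (ρ : Representation K A M) (γ : A) (n : ℕ) :
    (fakeDegree hGA hA ρ γ).coeff n = fakeDegreeCoeff hGA hA ρ γ n := by
  obtain ⟨N, hN⟩ := exists_coinvariantsHomog_eq_bot G
  have hzero : ∀ m, N ≤ m → fakeDegreeCoeff hGA hA ρ γ m = 0 := by
    intro m hm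
    have : Subsingleton (coinvariantsHomog G m) := by
      rw [hN m hm]; infer_instance
    have : Subsingleton (coinvariantsHomog G m ⊗[K] Module.Dual K M) :=
      inferInstance
    unfold fakeDegreeCoeff
    exact trace_eq_zero_of_subsingleton Subtype.val_injective.subsingleton _
  have hsupp : (Function.support fun m => monomial m (fakeDegreeCoeff hGA hA ρ γ m)) ⊆
      (Finset.range N : Set ℕ) := by
    intro m hm
    by_contra h
    refine hm ?_
    simp only [Finset.coe_range, Set.mem_Iio, not_lt] at h
    simp [hzero m h]
  unfold fakeDegree
  rw [finsum_eq_sum_of_support_subset _ hsupp, finsetSum_coeff]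
  simp only [coeff_monomial]
  rw [Finset.sum_ite_eq']
  split_ifs with h
  · rfl
  · exact (hzero n (by simpa using h)).symm

end Coinvariants

section Quotient

variable {K : Type u} [Field K] {V : Type v} [AddCommGroup V] [Module K V]

/-- `U` (in the role of `E^*`) is a graded complement of
`(S^L_+)^2` in `S^L_+`, stable under the normaliser of `L` in `GL(V)`. -/
structure IsStableComplement (L : Subgroup (V ≃ₗ[K] V)) (U : Submodule K (PolyFun K V)) :
    Prop where
  graded : U = ⨆ n : ℕ, U ⊓ homog K V n
  disjoint : U ⊓ (invariantsPos L * invariantsPos L) = ⊥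
  span : U ⊔ (invariantsPos L * invariantsPos L) = invariantsPos L
  stable : ∀ g ∈ Subgroup.normalizer (L : Set (V ≃ₗ[K] V)), ∀ f ∈ U, polyAct g f ∈ U

/-- The dual `W^*` of a space `W` of polynomial functions on `V`. -/
abbrev DualSpace (W : Submodule K (PolyFun K V)) : Type (max u v) := Module.Dual K W

/-- The contragredient action on `W^*` of a group `A ≤ GL(V)` that preserves `W ⊆ S`. -/
def dualHom (A : Subgroup (V ≃ₗ[K] V)) (W : Submodule K (PolyFun K V))
    (hW : ∀ g ∈ A, ∀ f ∈ W, polyAct g f ∈ W) : A →* (DualSpace W ≃ₗ[K] DualSpace W) :=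
  (LinearMap.GeneralLinearGroup.generalLinearEquiv K (DualSpace W)).toMonoidHom.comp
    (Representation.subrepresentation ((polyRep K V).comp A.subtype) W
      fun g f hf => hW g g.2 f hf).dual.asGroupHom

variable {L : Subgroup (V ≃ₗ[K] V)} {U : Submodule K (PolyFun K V)}

/-- The action of the normaliser of `L` on `E`, the dual of `E^*`. -/
def tangentHom (hU : IsStableComplement L U) :
    Subgroup.normalizer (L : Set (V ≃ₗ[K] V)) →* (DualSpace U ≃ₗ[K] DualSpace U) :=
  dualHom _ U hU.stable

/-- The image in `GL(E)` of a subgroup `H` of the normaliser of `L`. -/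
def tangentImage (hU : IsStableComplement L U) (H : Subgroup (V ≃ₗ[K] V)) :
    Subgroup (DualSpace U ≃ₗ[K] DualSpace U) :=
  (H.subgroupOf (Subgroup.normalizer (L : Set (V ≃ₗ[K] V)))).map (tangentHom hU)

/-- The graded component `E_n` of `E`, the dual of the component of degree `n` of `E^*`. -/
abbrev Component (U : Submodule K (PolyFun K V)) (n : ℕ) : Type (max u v) :=
  DualSpace (U ⊓ homog K V n)

/-- The action of the normaliser of `L` on `E_n`. -/
def componentHom (hU : IsStableComplement L U) (n : ℕ) :
    Subgroup.normalizer (L : Set (V ≃ₗ[K] V)) →* (Component U n ≃ₗ[K] Component U n) :=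
  dualHom _ (U ⊓ homog K V n)
    fun g hg f hf => ⟨hU.stable g hg f hf.1, polyAct_mem_homog g n hf.2⟩

/-- The image in `GL(E_n)` of a subgroup `H` of the normaliser of `L`. -/
def componentImage (hU : IsStableComplement L U) (n : ℕ) (H : Subgroup (V ≃ₗ[K] V)) :
    Subgroup (Component U n ≃ₗ[K] Component U n) :=
  (H.subgroupOf (Subgroup.normalizer (L : Set (V ≃ₗ[K] V)))).map (componentHom hU n)

variable {G Γ : Subgroup (V ≃ₗ[K] V)}

/-- `⟨G, Γ⟩` normalises `G` if `Γ` does. -/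
lemma sup_le_normalizer (hΓ : Γ ≤ Subgroup.normalizer (G : Set (V ≃ₗ[K] V))) :
    G ⊔ Γ ≤ Subgroup.normalizer (G : Set (V ≃ₗ[K] V)) :=
  sup_le Subgroup.le_normalizer hΓ

lemma componentImage_le_normalizer (hU : IsStableComplement L U) (n : ℕ)
    (hΓ : Γ ≤ Subgroup.normalizer (G : Set (V ≃ₗ[K] V))) :
    componentImage hU n Γ ≤ Subgroup.normalizer
      (componentImage hU n G : Set (Component U n ≃ₗ[K] Component U n)) := by
  refine le_trans (Subgroup.map_mono ?_) (Subgroup.le_normalizer_map _)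
  intro g hg
  rw [Subgroup.mem_subgroupOf] at hg
  rw [Subgroup.mem_normalizer_iff]
  intro h
  have := Subgroup.mem_normalizer_iff.1 (hΓ hg) (h : V ≃ₗ[K] V)
  simpa [Subgroup.mem_subgroupOf] using this

/-- The homomorphism from `⟨G, Γ⟩` to the group generated by the images of `G` and `Γ` in
`GL(E_n)`. -/
def toComponent (hU : IsStableComplement L U)
    (hG : G ≤ Subgroup.normalizer (L : Set (V ≃ₗ[K] V)))
    (hΓ : Γ ≤ Subgroup.normalizer (L : Set (V ≃ₗ[K] V))) (n : ℕ) :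
    ↥(G ⊔ Γ) →* ↥(componentImage hU n G ⊔ componentImage hU n Γ) :=
  ((componentHom hU n).comp (Subgroup.inclusion (sup_le hG hΓ))).codRestrict _ fun a => by
    unfold componentImage
    rw [← Subgroup.map_sup, ← Subgroup.subgroupOf_sup hG hΓ]
    exact ⟨_, Subgroup.mem_subgroupOf.2 a.2, rfl⟩

/-- The `⟨G, Γ⟩`-module `⨂_{n ∈ D} M_n`, where `M_n` is a module for the group generated by the
images of `G` and `Γ` in `GL(E_n)`. -/
def tensorRep (hU : IsStableComplement L U)
    (hG : G ≤ Subgroup.normalizer (L : Set (V ≃ₗ[K] V)))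
    (hΓ : Γ ≤ Subgroup.normalizer (L : Set (V ≃ₗ[K] V))) (D : Finset ℕ)
    {M : ℕ → Type w} [∀ n, AddCommGroup (M n)] [∀ n, Module K (M n)]
    (ρ : ∀ n, Representation K ↥(componentImage hU n G ⊔ componentImage hU n Γ) (M n)) :
    Representation K ↥(G ⊔ Γ) (⨂[K] n : D, M n) :=
  PiTensorProduct.mapMonoidHom.comp
    (MonoidHom.pi fun n : D => (ρ n).comp (toComponent hU hG hΓ n))

end Quotient

end

end ReflectionCoset

open ReflectionCoset

/-! Let `N` be the kernel of `G → ∏ GL(E_n)`, `n ∈ D`; it contains `L`. Projecting to `G`-invariants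
by averaging, and encoding degrees by a homothety, one finds that for `t ≠ 0` the value `F_{M,γ}(t)`
is the average over `g ∈ G` of `Tr(gγt, S_G) · Tr((gγ)⁻¹, M)`, where `t` multiplies linear forms by
`t` (`eval_fakeDegree`). The second factor depends only on `g` modulo `N`, so the first may be
averaged over `N`-translates: it becomes a trace on the `N`-invariants of `S_G`.

The main point is that these invariants are the tensor product of the coinvariant algebras of the
groups `Ḡ_n`, compatibly with the actions (`tensorComponentMap`). Every `N`-invariant class is
reached because `E^*` generates `S^L ⊇ S^N` modulo arbitrarily high powers of `S^L_+`, and high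
powers die in `S_G` (`IsStableComplement.mk_mem`).

Injectivity is a dimension count. A reflection of `E` moves only one `E_n`, so each `Ḡ_n` is a
reflection group and `G/N` is the product of the `Ḡ_n` (`componentsHom_surjective`). Chevalley's
argument bounds the dimension of the coinvariants of `Ḡ_n` above by `|Ḡ_n|`
(`IsReflectionGroup.finrank_coinvariants_le`); Nakayama's lemma and Dedekind's independence of the
`|G/N|` distinct homomorphisms `S^N → S` bound the dimension of the image below by `|G/N|`
(`card_le_of_span_coinvariants`). These two inequalities suffice: neither freeness of `S` over its
invariants nor polynomiality of invariant rings is needed.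

Finally the homothety `t` of `V` induces the homothety `t^n` of `E_n`, the average over `G` is an
average over `∏ Ḡ_n`, and the sum factors. Agreement at all `t ≠ 0` gives equality of polynomials.
-/

namespace ReflectionCoset

noncomputable section

universe u v w

/-! ### Counting by independence of characters -/

section Counting

/-- If a family `p` spans the domain of a family of distinct ring homomorphisms up to a common
denominator, with coefficients on which these homomorphisms agree, then `p` is at least as large
as the family. -/
lemma card_le_card_of_span {B R X ι : Type*} [CommRing B] [CommRing R] [IsDomain R] [Fintype X]
    [Fintype ι] (χ : X → B →+* R) (hχ : Function.Injective χ) (p : ι → B) (c : B) (c' : R)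
    (hc' : c' ≠ 0) (hc : ∀ x, χ x c = c')
    (hp : ∀ b, ∃ r : ι → B, (∀ x y i, χ x (r i) = χ y (r i)) ∧ c * b = ∑ i, r i * p i) :
    Fintype.card X ≤ Fintype.card ι := by
  classical
  by_contra hlt
  -- More vectors than coordinates: there is a relation among the `χ x` on the family `p`. Since the
  -- `r i` have a common image under all `χ x`, it extends to all of `B`, against Dedekind's
  -- theorem.
  have hdep : ¬ LinearIndependent R fun x : X => fun i => χ x (p i) := by
    intro h
    have := h.fintype_card_le_finrank
    rw [Module.finrank_fintype_fun_eq_card] at this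
    exact hlt this
  rw [Fintype.not_linearIndependent_iff] at hdep
  obtain ⟨v, hv, x₀, hx₀⟩ := hdep
  have hv' : ∀ i, ∑ x, v x * χ x (p i) = 0 := fun i => by
    simpa using congrFun hv i
  have hind : LinearIndependent R fun x : X => ((χ x : B →* R) : B → R) :=
    (linearIndependent_monoidHom B R).comp (fun x : X => (χ x : B →* R)) fun x y hxy =>
      hχ (RingHom.ext fun b => DFunLike.congr_fun hxy b)
  refine hx₀ (Fintype.linearIndependent_iff.1 hind v (funext fun b => ?_) x₀)
  obtain ⟨r, hr, hb⟩ := hp b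
  have h1 : c' * ∑ x, v x * χ x b = 0 := by
    calc c' * ∑ x, v x * χ x b = ∑ x, v x * χ x (c * b) := by
          rw [Finset.mul_sum]
          refine Finset.sum_congr rfl fun x _ => ?_
          rw [map_mul, hc]; ring
      _ = ∑ x, ∑ i, χ x₀ (r i) * (v x * χ x (p i)) := by
          refine Finset.sum_congr rfl fun x _ => ?_
          rw [hb, map_sum, Finset.mul_sum]
          refine Finset.sum_congr rfl fun i _ => ?_
          rw [map_mul, hr x x₀]; ring
      _ = 0 := by
          rw [Finset.sum_comm]
          refine Finset.sum_eq_zero fun i _ => ?_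
          rw [← Finset.mul_sum, hv', mul_zero]
  simpa using (mul_eq_zero.1 h1).resolve_left hc'

end Counting

/-! ### Invariants and averaging -/

section Invariants

variable {K : Type u} [Field K] {V : Type v} [AddCommGroup V] [Module K V]

/-- The algebra of `H`-invariant polynomial functions. -/
def invariantAlgebra (H : Subgroup (V ≃ₗ[K] V)) : Subalgebra K (PolyFun K V) where
  carrier := {f | ∀ g ∈ H, polyAct g f = f}
  mul_mem' ha hb g hg := by rw [map_mul, ha g hg, hb g hg]
  add_mem' ha hb g hg := by rw [map_add, ha g hg, hb g hg]
  algebraMap_mem' r g _ := by rw [AlgHom.commutes]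

lemma mem_invariantAlgebra {H : Subgroup (V ≃ₗ[K] V)} {f : PolyFun K V} :
    f ∈ invariantAlgebra H ↔ ∀ g ∈ H, polyAct g f = f := Iff.rfl

lemma mem_invariantsPos {H : Subgroup (V ≃ₗ[K] V)} {f : PolyFun K V} :
    f ∈ invariantsPos H ↔ f ∈ invariantAlgebra H ∧ SymmetricAlgebra.algebraMapInv f = 0 := by
  refine and_congr ⟨fun h g hg => h ⟨g, hg⟩, fun h g => h g g.2⟩ Iff.rfl

lemma polyAct_mul_apply (g h : V ≃ₗ[K] V) (f : PolyFun K V) :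
    polyAct (g * h) f = polyAct g (polyAct h f) := by
  rw [polyAct_mul]; rfl

lemma polyAct_one_apply (f : PolyFun K V) : polyAct (1 : V ≃ₗ[K] V) f = f := by
  rw [polyAct_one]; rfl

lemma polyAct_inv_apply_self (g : V ≃ₗ[K] V) (f : PolyFun K V) :
    polyAct g⁻¹ (polyAct g f) = f := by
  rw [← polyAct_mul_apply, inv_mul_cancel, polyAct_one_apply]

lemma polyAct_apply_inv_self (g : V ≃ₗ[K] V) (f : PolyFun K V) :
    polyAct g (polyAct g⁻¹ f) = f := by
  rw [← polyAct_mul_apply, mul_inv_cancel, polyAct_one_apply]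

/-- In the polynomial algebra, the coefficient of the monomial `X i` recovers the `i`-th coordinate
of a linear form. -/
lemma ι_injective : Function.Injective (SymmetricAlgebra.ι K (Module.Dual K V)) := by
  intro x y hxy
  let b := Module.Free.chooseBasis K (Module.Dual K V)
  have h := congrArg (SymmetricAlgebra.equivMvPolynomial b) hxy
  have key : ∀ (x : Module.Dual K V) (i),
      (SymmetricAlgebra.equivMvPolynomial b (SymmetricAlgebra.ι K _ x)).coeff (Finsupp.single i 1) =
        b.repr x i := by
    intro x i
    have : (MvPolynomial.lcoeff K (Finsupp.single i 1)) ∘ₗ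
        (SymmetricAlgebra.equivMvPolynomial b).toLinearMap ∘ₗ SymmetricAlgebra.ι K _ =
        b.coord i := by
      refine b.ext fun j => ?_
      simp [SymmetricAlgebra.equivMvPolynomial_ι_apply, MvPolynomial.coeff_X, Finsupp.single_apply,
        Finsupp.single_left_inj]
    exact DFunLike.congr_fun this x
  exact b.repr.injective (Finsupp.ext fun i => by rw [← key, ← key, h])

/-- Linear forms separate the points of `V`. Distinct group elements thus give distinct characters,
as Dedekind's theorem requires. -/
lemma polyAct_injective : Function.Injective (polyAct : (V ≃ₗ[K] V) → _) := by
  intro g h hgh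
  have key : ∀ x, g⁻¹ x = h⁻¹ x := by
    intro x
    rw [← sub_eq_zero, ← Module.forall_dual_apply_eq_zero_iff K]
    intro φ
    have h1 := DFunLike.congr_fun hgh (SymmetricAlgebra.ι K _ φ)
    rw [polyAct_ι, polyAct_ι] at h1
    have h2 := DFunLike.congr_fun (ι_injective h1) x
    simp only [LinearMap.comp_apply] at h2
    rw [map_sub, sub_eq_zero]
    exact h2
  exact inv_injective (LinearEquiv.ext key)

/-- The constant term is invariant. -/
lemma algebraMapInv_polyAct (g : V ≃ₗ[K] V) (f : PolyFun K V) :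
    SymmetricAlgebra.algebraMapInv (polyAct g f) = SymmetricAlgebra.algebraMapInv f := by
  have h := polyAct_mem_posPart g (f := f - algebraMap K _ (SymmetricAlgebra.algebraMapInv f)) (by
    change SymmetricAlgebra.algebraMapInv _ = _
    rw [map_sub, AlgHom.commutes]; simp)
  have h' : SymmetricAlgebra.algebraMapInv
    (polyAct g (f - algebraMap K _ (SymmetricAlgebra.algebraMapInv f))) = 0 := h
  rw [map_sub, AlgHom.commutes, map_sub, AlgHom.commutes] at h'
  simpa [sub_eq_zero] using h'

/-- The Reynolds operator of a finite group. -/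
def reynolds (H : Subgroup (V ≃ₗ[K] V)) [Fintype H] : PolyFun K V →ₗ[K] PolyFun K V :=
  (Fintype.card H : K)⁻¹ • ∑ h : H, (polyAct (h : V ≃ₗ[K] V)).toLinearMap

lemma reynolds_apply (H : Subgroup (V ≃ₗ[K] V)) [Fintype H] (f : PolyFun K V) :
    reynolds H f = (Fintype.card H : K)⁻¹ • ∑ h : H, polyAct (h : V ≃ₗ[K] V) f := by
  simp [reynolds]

lemma sum_polyAct_mem (H : Subgroup (V ≃ₗ[K] V)) [Fintype H] (f : PolyFun K V) :
    ∑ h : H, polyAct (h : V ≃ₗ[K] V) f ∈ invariantAlgebra H := by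
  intro g hg
  rw [map_sum]
  refine Fintype.sum_equiv (Equiv.mulLeft ⟨g, hg⟩) _ _ fun h => ?_
  rw [← polyAct_mul_apply]
  rfl

lemma reynolds_mem (H : Subgroup (V ≃ₗ[K] V)) [Fintype H] (f : PolyFun K V) :
    reynolds H f ∈ invariantAlgebra H := by
  rw [reynolds_apply]
  exact Subalgebra.smul_mem _ (sum_polyAct_mem H f) _

lemma reynolds_mul (H : Subgroup (V ≃ₗ[K] V)) [Fintype H] {r : PolyFun K V}
    (hr : r ∈ invariantAlgebra H) (f : PolyFun K V) : reynolds H (r * f) = r * reynolds H f := by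
  rw [reynolds_apply, reynolds_apply, mul_smul_comm, Finset.mul_sum]
  congr 1
  refine Finset.sum_congr rfl fun h _ => ?_
  rw [map_mul, hr h h.2]

lemma card_cast_ne_zero [CharZero K] (H : Subgroup (V ≃ₗ[K] V)) [Fintype H] :
    (Fintype.card H : K) ≠ 0 :=
  Nat.cast_ne_zero.2 Fintype.card_ne_zero

lemma reynolds_of_mem [CharZero K] (H : Subgroup (V ≃ₗ[K] V)) [Fintype H] {f : PolyFun K V}
    (hf : f ∈ invariantAlgebra H) : reynolds H f = f := by
  rw [reynolds_apply, Finset.sum_congr rfl fun (h : H) _ => hf h h.2, Finset.sum_const,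
    Finset.card_univ, ← Nat.cast_smul_eq_nsmul K, smul_smul, inv_mul_cancel₀ (card_cast_ne_zero H),
    one_smul]

/-- A family of polynomial functions that is linearly independent over the invariants of `H` has
at most `|H|` members. -/
lemma card_le_of_independent_over_invariants (H : Subgroup (V ≃ₗ[K] V)) [Fintype H]
    {m : ℕ} (f : Fin m → PolyFun K V)
    (hf : ∀ r : Fin m → PolyFun K V, (∀ j, r j ∈ invariantAlgebra H) → ∑ j, r j * f j = 0 → r = 0) :
    m ≤ Fintype.card H := by
  classical
  by_contra hlt
  have hdep : ¬ LinearIndependent (PolyFun K V)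
      fun j : Fin m => fun h : H => polyAct (h : V ≃ₗ[K] V) (f j) := by
    intro h
    have := h.fintype_card_le_finrank
    rw [Module.finrank_fintype_fun_eq_card, Fintype.card_fin] at this
    exact hlt this
  rw [Fintype.not_linearIndependent_iff] at hdep
  obtain ⟨a, ha, j₀, hj₀⟩ := hdep
  have ha' : ∀ h : H, ∑ j, a j * polyAct (h : V ≃ₗ[K] V) (f j) = 0 := fun h => by
    simpa using congrFun ha h
  -- Apply `h` to the relation at `h⁻¹`, multiply by `h b` and sum over `h`: this is a relation
  -- among the `f j` whose coefficients are the invariants `∑ h (b * a j)`, so these vanish.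
  have hzero : ∀ b, ∑ h : H, polyAct (h : V ≃ₗ[K] V) (b * a j₀) = 0 := by
    intro b
    refine congrFun (hf (fun j => ∑ h : H, polyAct (h : V ≃ₗ[K] V) (b * a j))
      (fun j => sum_polyAct_mem H _) ?_) j₀
    simp only [Finset.sum_mul]
    rw [Finset.sum_comm]
    refine Finset.sum_eq_zero fun h _ => ?_
    have h1 := congrArg (polyAct (h : V ≃ₗ[K] V)) (ha' h⁻¹)
    rw [map_sum, map_zero] at h1
    calc _ = ∑ j, polyAct (h : V ≃ₗ[K] V) b * polyAct (h : V ≃ₗ[K] V)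
              (a j * polyAct ((h⁻¹ : H) : V ≃ₗ[K] V) (f j)) := by
          refine Finset.sum_congr rfl fun j _ => ?_
          rw [map_mul, map_mul, InvMemClass.coe_inv, polyAct_apply_inv_self, mul_assoc]
      _ = 0 := by rw [← Finset.mul_sum, h1, mul_zero]
  have hind : LinearIndependent (PolyFun K V) fun h : H =>
      ((polyAct (h : V ≃ₗ[K] V) : PolyFun K V →* PolyFun K V) : PolyFun K V → PolyFun K V) :=
    (linearIndependent_monoidHom (PolyFun K V) (PolyFun K V)).comp
      (fun h : H => (polyAct (h : V ≃ₗ[K] V) : PolyFun K V →* PolyFun K V)) fun x y hxy =>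
      Subtype.ext (polyAct_injective (AlgHom.ext fun b => DFunLike.congr_fun hxy b))
  -- The sums in `hzero` are a relation among the characters `b ↦ h b` with coefficients `h (a j₀)`;
  -- the coefficient at `h = 1` is `a j₀` itself.
  have h2 := Fintype.linearIndependent_iff.1 hind (fun h => polyAct (h : V ≃ₗ[K] V) (a j₀))
    (funext fun b => ?_) 1
  · simp only [OneMemClass.coe_one, polyAct_one_apply] at h2
    exact hj₀ h2
  · simpa [mul_comm] using hzero b

end Invariants

/-! ### Chevalley's bound for the coinvariants of a reflection group -/

section Chevalley

variable {K : Type u} [Field K] {V : Type v} [AddCommGroup V] [Module K V]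

variable (K V) in
/-- The polynomial functions of degree at most `d`. -/
def degreeLE (d : ℕ) : Submodule K (PolyFun K V) :=
  (LinearMap.range (SymmetricAlgebra.ι K (Module.Dual K V)) ⊔ 1) ^ d

lemma one_le_degreeLE_one :
    (1 : Submodule K (PolyFun K V)) ≤ LinearMap.range (SymmetricAlgebra.ι K (Module.Dual K V)) ⊔ 1 :=
  le_sup_right

lemma degreeLE_mono {d e : ℕ} (h : d ≤ e) : degreeLE K V d ≤ degreeLE K V e :=
  pow_le_pow_right' one_le_degreeLE_one h

lemma exists_mem_degreeLE (f : PolyFun K V) : ∃ d, f ∈ degreeLE K V d := by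
  induction f using SymmetricAlgebra.induction with
  | algebraMap r => exact ⟨0, by rw [degreeLE, pow_zero]; exact Submodule.mem_one.2 ⟨r, rfl⟩⟩
  | ι x => exact ⟨1, by rw [degreeLE, pow_one]; exact Submodule.mem_sup_left ⟨x, rfl⟩⟩
  | mul a b ha hb =>
    obtain ⟨d, hd⟩ := ha
    obtain ⟨e, he⟩ := hb
    exact ⟨d + e, by rw [degreeLE, pow_add]; exact Submodule.mul_mem_mul hd he⟩
  | add a b ha hb =>
    obtain ⟨d, hd⟩ := ha
    obtain ⟨e, he⟩ := hb
    exact ⟨max d e, add_mem (degreeLE_mono (le_max_left _ _) hd)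
      (degreeLE_mono (le_max_right _ _) he)⟩

lemma polyAct_mem_degreeLE_one (g : V ≃ₗ[K] V) {f : PolyFun K V} (hf : f ∈ degreeLE K V 1) :
    polyAct g f ∈ degreeLE K V 1 := by
  rw [degreeLE, pow_one] at hf ⊢
  obtain ⟨_, ⟨φ, rfl⟩, _, hr, rfl⟩ := Submodule.mem_sup.1 hf
  obtain ⟨r, rfl⟩ := Submodule.mem_one.1 hr
  rw [map_add, polyAct_ι, AlgHom.commutes]
  exact Submodule.add_mem_sup ⟨_, rfl⟩ hr

/-- The linear form whose kernel is the reflecting hyperplane. -/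
lemma IsPseudoreflection.exists_form {s : V ≃ₗ[K] V} (hs : IsPseudoreflection s) :
    ∃ α : Module.Dual K V, α ≠ 0 ∧
      ∀ φ : Module.Dual K V, ∃ k : K, φ ∘ₗ (s⁻¹ : V ≃ₗ[K] V).toLinearMap - φ = k • α := by
  set H := LinearMap.ker (s.toLinearMap - LinearMap.id) with hH
  let b := Module.basisUnique Unit hs.2
  refine ⟨b.coord () ∘ₗ H.mkQ, ?_, fun φ => ?_⟩
  · intro h0
    obtain ⟨x, hx⟩ := Submodule.mkQ_surjective H (b ())
    have := DFunLike.congr_fun h0 x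
    rw [LinearMap.comp_apply, hx] at this
    simp at this
  -- The form `φ ∘ s⁻¹ - φ` kills the hyperplane, so it factors through a one-dimensional quotient.
  · have hle : H ≤ LinearMap.ker (φ ∘ₗ (s⁻¹ : V ≃ₗ[K] V).toLinearMap - φ) := by
      intro x hx
      rw [hH, LinearMap.mem_ker, LinearMap.sub_apply, sub_eq_zero] at hx
      have hx' : (s⁻¹ : V ≃ₗ[K] V) x = x := by
        rw [LinearEquiv.coe_inv, LinearEquiv.symm_apply_eq]
        exact hx.symm
      rw [LinearMap.mem_ker, LinearMap.sub_apply, LinearMap.comp_apply, LinearEquiv.coe_coe, hx',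
        sub_self]
    refine ⟨H.liftQ _ hle (b ()), ?_⟩
    have : H.liftQ _ hle = (H.liftQ _ hle (b ())) • b.coord () :=
      b.ext fun i => by simp
    ext x
    have h1 := DFunLike.congr_fun this (H.mkQ x)
    simpa using h1

/-- Divided differences with respect to a reflection. -/
lemma exists_divided_difference {s : V ≃ₗ[K] V} {α : Module.Dual K V}
    (hα : ∀ φ : Module.Dual K V, ∃ k : K, φ ∘ₗ (s⁻¹ : V ≃ₗ[K] V).toLinearMap - φ = k • α) (d : ℕ) :
    ∀ f ∈ degreeLE K V (d + 1), ∃ q ∈ degreeLE K V d,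
      polyAct s f - f = SymmetricAlgebra.ι K _ α * q := by
  have h1 : ∀ f ∈ degreeLE K V 1, ∃ k : K,
      polyAct s f - f = SymmetricAlgebra.ι K _ α * algebraMap K _ k := by
    intro f hf
    rw [degreeLE, pow_one] at hf
    obtain ⟨_, ⟨φ, rfl⟩, _, hr, rfl⟩ := Submodule.mem_sup.1 hf
    obtain ⟨r, rfl⟩ := Submodule.mem_one.1 hr
    obtain ⟨k, hk⟩ := hα φ
    refine ⟨k, ?_⟩
    have h2 := congrArg (SymmetricAlgebra.ι K (Module.Dual K V)) hk
    rw [map_sub, map_smul] at h2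
    rw [map_add, polyAct_ι, AlgHom.commutes, add_sub_add_right_eq_sub, h2, Algebra.smul_def, mul_comm]
  induction d with
  | zero =>
    intro f hf
    obtain ⟨k, hk⟩ := h1 f hf
    exact ⟨algebraMap K _ k, by rw [degreeLE, pow_zero]; exact Submodule.mem_one.2 ⟨k, rfl⟩, hk⟩
  | succ d ih =>
    intro f hf
    rw [degreeLE, pow_succ'] at hf
    induction hf using Submodule.mul_induction_on' with
    | mem_mul_mem a ha b hb =>
      have ha' : a ∈ degreeLE K V 1 := by rwa [degreeLE, pow_one]
      obtain ⟨k, hk⟩ := h1 a ha'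
      obtain ⟨q, hq, hq'⟩ := ih b hb
      -- Twisted Leibniz rule: `s(ab) - ab = s(a) (s(b) - b) + (s(a) - a) b`.
      refine ⟨polyAct s a * q + k • b, add_mem ?_ (Submodule.smul_mem _ _ hb), ?_⟩
      · have h2 := polyAct_mem_degreeLE_one s ha'
        rw [degreeLE, pow_one] at h2
        rw [degreeLE, pow_succ']
        exact Submodule.mul_mem_mul h2 hq
      · rw [map_mul, Algebra.smul_def]
        linear_combination (polyAct s a) * hq' + b * hk
    | add a _ b _ ha hb =>
      obtain ⟨q, hq, hq'⟩ := ha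
      obtain ⟨p, hp, hp'⟩ := hb
      exact ⟨q + p, add_mem hq hp, by rw [map_add]; linear_combination hq' + hp'⟩

lemma polyAct_mem_coinvariantIdeal {G : Subgroup (V ≃ₗ[K] V)} {g : V ≃ₗ[K] V} (hg : g ∈ G)
    {f : PolyFun K V} (hf : f ∈ coinvariantIdeal G) : polyAct g f ∈ coinvariantIdeal G :=
  coinvariantIdeal_le_comap (Subgroup.le_normalizer hg) hf

/-- Chevalley's lemma: in a relation with invariant coefficients, a coefficient that is not, even
locally at the origin, a combination of the others is that of an element of the ideal of
coinvariants. -/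
lemma IsReflectionGroup.mem_coinvariantIdeal_of_relation [CharZero K] {W : Subgroup (V ≃ₗ[K] V)}
    (hW : IsReflectionGroup W) {m : ℕ} {g₀ : PolyFun K V} {g : Fin m → PolyFun K V}
    (hg₀ : g₀ ∈ invariantAlgebra W) (hg : ∀ i, g i ∈ invariantAlgebra W)
    (hnot : ∀ c ∈ invariantAlgebra W, SymmetricAlgebra.algebraMapInv c ≠ 0 →
      ∀ a : Fin m → PolyFun K V, (∀ i, a i ∈ invariantAlgebra W) → c * g₀ ≠ ∑ i, a i * g i)
    (d : ℕ) : ∀ (h₀ : PolyFun K V) (h : Fin m → PolyFun K V), h₀ ∈ degreeLE K V d →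
      g₀ * h₀ + ∑ i, g i * h i = 0 → h₀ ∈ coinvariantIdeal W := by
  have := hW.1
  have := Fintype.ofFinite W
  -- If the reflections fix `h₀` modulo the ideal, so does the group they generate, and `h₀` is
  -- congruent to its average. Averaging the relation shows that this average has no constant term:
  -- otherwise it would serve as the `c` excluded by `hnot`.
  have final : ∀ (h₀ : PolyFun K V) (h : Fin m → PolyFun K V), g₀ * h₀ + ∑ i, g i * h i = 0 →
      (∀ s ∈ W, IsPseudoreflection s → polyAct s h₀ - h₀ ∈ coinvariantIdeal W) →
      h₀ ∈ coinvariantIdeal W := by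
    intro h₀ h hrel hs
    have hall : ∀ x ∈ W, polyAct x h₀ - h₀ ∈ coinvariantIdeal W := by
      intro x hx
      rw [← hW.2] at hx
      have hmem : ∀ {y}, y ∈ Subgroup.closure {g | g ∈ W ∧ IsPseudoreflection g} → y ∈ W :=
        fun {y} hy => by rwa [hW.2] at hy
      induction hx using Subgroup.closure_induction with
      | mem x hx => exact hs x hx.1 hx.2
      | one => rw [polyAct_one_apply, sub_self]; exact zero_mem _
      | mul x y hx hy ihx ihy =>
        have h1 : polyAct (x * y) h₀ - h₀ = polyAct x (polyAct y h₀ - h₀) + (polyAct x h₀ - h₀) := by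
          rw [polyAct_mul_apply, map_sub]; ring
        rw [h1]
        exact add_mem (polyAct_mem_coinvariantIdeal (hmem hx) ihy) ihx
      | inv x hx ihx =>
        have h1 : polyAct x⁻¹ h₀ - h₀ = -polyAct x⁻¹ (polyAct x h₀ - h₀) := by
          rw [map_sub, polyAct_inv_apply_self]; ring
        rw [h1]
        exact neg_mem (polyAct_mem_coinvariantIdeal (inv_mem (hmem hx)) ihx)
    have havg : reynolds W h₀ - h₀ ∈ coinvariantIdeal W := by
      have h1 : reynolds W h₀ - h₀ =
          algebraMap K _ (Fintype.card W : K)⁻¹ * ∑ x : W, (polyAct (x : V ≃ₗ[K] V) h₀ - h₀) := by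
        rw [reynolds_apply, Finset.sum_sub_distrib, ← Algebra.smul_def, smul_sub, Finset.sum_const,
          Finset.card_univ, ← Nat.cast_smul_eq_nsmul K, smul_smul,
          inv_mul_cancel₀ (card_cast_ne_zero W), one_smul]
      rw [h1]
      exact Ideal.mul_mem_left _ _ (Ideal.sum_mem _ fun x _ => hall x x.2)
    have hrel' : reynolds W h₀ * g₀ = ∑ i, (-reynolds W (h i)) * g i := by
      have h1 := congrArg (reynolds W) hrel
      rw [map_add, map_sum, map_zero, reynolds_mul W hg₀,
        Finset.sum_congr rfl fun i _ => reynolds_mul W (hg i) (h i)] at h1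
      rw [mul_comm, eq_neg_of_add_eq_zero_left h1, ← Finset.sum_neg_distrib]
      exact Finset.sum_congr rfl fun i _ => by ring
    have hc : SymmetricAlgebra.algebraMapInv (reynolds W h₀) = 0 := by
      by_contra hne
      exact hnot _ (reynolds_mem W h₀) hne _ (fun i => neg_mem (reynolds_mem W (h i))) hrel'
    have h2 : reynolds W h₀ ∈ coinvariantIdeal W :=
      Ideal.subset_span (mem_invariantsPos.2 ⟨reynolds_mem W h₀, hc⟩)
    have h3 := sub_mem h2 havg
    rwa [sub_sub_cancel] at h3
  induction d with
  | zero =>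
    intro h₀ h hh₀ hrel
    refine final h₀ h hrel fun s _ _ => ?_
    rw [degreeLE, pow_zero] at hh₀
    obtain ⟨r, rfl⟩ := Submodule.mem_one.1 hh₀
    rw [AlgHom.commutes, sub_self]
    exact zero_mem _
  | succ d ih =>
    intro h₀ h hh₀ hrel
    refine final h₀ h hrel fun s hsW hs => ?_
    obtain ⟨α, hα0, hα⟩ := hs.exists_form
    obtain ⟨q₀, hq₀, hq₀'⟩ := exists_divided_difference hα d h₀ hh₀
    have hq : ∀ i, ∃ q, polyAct s (h i) - h i = SymmetricAlgebra.ι K _ α * q := by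
      intro i
      obtain ⟨e, he⟩ := exists_mem_degreeLE (h i)
      obtain ⟨q, _, hq⟩ := exists_divided_difference hα e (h i) (degreeLE_mono e.le_succ he)
      exact ⟨q, hq⟩
    choose q hq using hq
    rw [hq₀']
    refine Ideal.mul_mem_left _ _ (ih q₀ q hq₀ ?_)
    -- Subtract the relation from its image under `s`. The coefficients being invariant, `α` can be
    -- cancelled, leaving a relation among divided differences, in which the degree bound for `h₀`
    -- has dropped by one.
    have h1 : SymmetricAlgebra.ι K _ α * (g₀ * q₀ + ∑ i, g i * q i) = 0 := by
      have h2 := congrArg (polyAct s) hrel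
      rw [map_add, map_sum, map_zero, map_mul, hg₀ s hsW,
        Finset.sum_congr rfl fun i _ => show polyAct s (g i * h i) = g i * polyAct s (h i) by
          rw [map_mul, hg i s hsW]] at h2
      have h3 : ∑ i, g i * (SymmetricAlgebra.ι K _ α * q i) =
          ∑ i, g i * polyAct s (h i) - ∑ i, g i * h i := by
        rw [← Finset.sum_sub_distrib]
        exact Finset.sum_congr rfl fun i _ => by rw [← hq i]; ring
      rw [mul_add, Finset.mul_sum, Finset.sum_congr rfl fun i _ =>
        show SymmetricAlgebra.ι K _ α * (g i * q i) = g i * (SymmetricAlgebra.ι K _ α * q i) by ring,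
        h3]
      linear_combination h2 - hrel - g₀ * hq₀'
    refine (mul_eq_zero.1 h1).resolve_left fun h0 => hα0 (ι_injective ?_)
    rw [h0, map_zero]

/-- For a reflection group, polynomial functions that are linearly independent in the coinvariant
algebra are linearly independent over the invariants. -/
lemma IsReflectionGroup.independent_over_invariants [CharZero K] {W : Subgroup (V ≃ₗ[K] V)}
    (hW : IsReflectionGroup W) {m : ℕ} : ∀ f : Fin m → PolyFun K V,
      LinearIndependent K (fun j => Ideal.Quotient.mkₐ K (coinvariantIdeal W) (f j)) →
      ∀ r : Fin m → PolyFun K V, (∀ j, r j ∈ invariantAlgebra W) → ∑ j, r j * f j = 0 → r = 0 := by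
  induction m with
  | zero => intro f _ r _ _; exact Subsingleton.elim _ _
  | succ m ih =>
    intro f hf r hr hrel
    rw [Fin.sum_univ_succ] at hrel
    -- Either `r 0` is, up to an invariant factor that is nonzero at the origin, a combination of
    -- the other coefficients and can be eliminated, or Chevalley's lemma puts `f 0` in the ideal,
    -- which independence forbids.
    by_cases hex : ∃ c ∈ invariantAlgebra W, SymmetricAlgebra.algebraMapInv c ≠ 0 ∧
      ∃ a : Fin m → PolyFun K V, (∀ i, a i ∈ invariantAlgebra W) ∧
        c * r 0 = ∑ i, a i * r i.succ
    · obtain ⟨c, hc, hc0, a, ha, hcr⟩ := hex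
      -- In the coinvariant algebra an invariant is its constant term. Since `c` has a nonzero one,
      -- the family left after elimination still has independent classes.
      have hmk : ∀ x ∈ invariantAlgebra W, Ideal.Quotient.mkₐ K (coinvariantIdeal W) x =
          algebraMap K _ (SymmetricAlgebra.algebraMapInv x) := by
        intro x hx
        rw [← AlgHom.commutes (Ideal.Quotient.mkₐ K (coinvariantIdeal W)), ← sub_eq_zero, ← map_sub]
        refine Ideal.Quotient.eq_zero_iff_mem.2 (Ideal.subset_span (mem_invariantsPos.2
          ⟨sub_mem hx (Subalgebra.algebraMap_mem _ _), ?_⟩))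
        rw [map_sub, AlgHom.commutes]
        simp
      have hsucc : (fun i : Fin m => r i.succ) = 0 := by
        refine ih (fun i => c * f i.succ + a i * f 0) ?_ _ (fun i => hr _) ?_
        · rw [Fintype.linearIndependent_iff] at hf ⊢
          intro k hk i
          have h1 := hf (Fin.cons (∑ i, k i * SymmetricAlgebra.algebraMapInv (a i))
            fun i => k i * SymmetricAlgebra.algebraMapInv c) ?_ i.succ
          · rw [Fin.cons_succ] at h1
            exact (mul_eq_zero.1 h1).resolve_right hc0
          · rw [← hk, Fin.sum_univ_succ]
            simp only [Fin.cons_zero, Fin.cons_succ]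
            rw [Finset.sum_smul, ← Finset.sum_add_distrib]
            refine Finset.sum_congr rfl fun i _ => ?_
            rw [map_add, map_mul, map_mul, hmk _ hc, hmk _ (ha i), ← Algebra.smul_def,
              ← Algebra.smul_def, smul_add, smul_smul, smul_smul, add_comm]
        · have h1 : ∑ i : Fin m, r i.succ * (c * f i.succ + a i * f 0) =
              c * ∑ i : Fin m, r i.succ * f i.succ + (∑ i : Fin m, a i * r i.succ) * f 0 := by
            rw [Finset.mul_sum, Finset.sum_mul, ← Finset.sum_add_distrib]
            exact Finset.sum_congr rfl fun i _ => by ring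
          rw [h1, ← hcr]
          linear_combination c * hrel
      have h0 : r 0 = 0 := by
        have h1 : c * r 0 = 0 := by
          rw [hcr]
          exact Finset.sum_eq_zero fun i _ => by rw [show r i.succ = 0 from congrFun hsucc i, mul_zero]
        refine (mul_eq_zero.1 h1).resolve_left fun h2 => hc0 (by rw [h2, map_zero])
      funext j
      exact Fin.cases h0 (fun i => congrFun hsucc i) j
    · exfalso
      push Not at hex
      obtain ⟨d, hd⟩ := exists_mem_degreeLE (f 0)
      have := hW.mem_coinvariantIdeal_of_relation (hr 0) (fun i => hr (Fin.succ i)) hex d (f 0)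
        (fun i => f i.succ) hd hrel
      exact hf.ne_zero 0 (Ideal.Quotient.eq_zero_iff_mem.2 this)

/-- The coinvariant algebra of a reflection group has dimension at most the order of the group. -/
lemma IsReflectionGroup.finrank_coinvariants_le [CharZero K] {W : Subgroup (V ≃ₗ[K] V)}
    (hW : IsReflectionGroup W) : Module.finrank K (Coinvariants W) ≤ Nat.card W := by
  have := hW.1
  have := Fintype.ofFinite W
  rw [Nat.card_eq_fintype_card]
  obtain ⟨b, hb⟩ := exists_linearIndependent_of_le_finrank (le_refl (Module.finrank K (Coinvariants W)))
  choose f hf using fun j => Ideal.Quotient.mkₐ_surjective K (coinvariantIdeal W) (b j)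
  refine card_le_of_independent_over_invariants W f (hW.independent_over_invariants f ?_)
  simpa only [hf] using hb

end Chevalley

/-! ### Finiteness, and the lower bound by Nakayama's lemma -/

section Finiteness

/-- Nakayama's lemma, relative to a submodule `Q`. -/
lemma exists_sub_one_mem_and_smul_mem {R M : Type*} [CommRing R] [AddCommGroup M] [Module R M]
    (I : Ideal R) (N Q : Submodule R M) (hN : N.FG) (hle : N ≤ Q ⊔ I • N) :
    ∃ r : R, r - 1 ∈ I ∧ ∀ n ∈ N, r • n ∈ Q := by
  have h : N.map Q.mkQ ≤ I • N.map Q.mkQ := by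
    rw [← Submodule.map_smul'']
    refine (Submodule.map_mono hle).trans ?_
    rw [Submodule.map_sup, Submodule.mkQ_map_self, bot_sup_eq]
  obtain ⟨r, hr, hr'⟩ :=
    Submodule.exists_sub_one_mem_and_smul_eq_zero_of_fg_of_le_smul I _ (hN.map _) h
  refine ⟨r, hr, fun n hn => ?_⟩
  have h1 := hr' _ ⟨n, hn, rfl⟩
  rwa [← map_smul, Submodule.mkQ_apply, Submodule.Quotient.mk_eq_zero] at h1

variable {K : Type u} [Field K] {V : Type v} [AddCommGroup V] [Module K V]

lemma posPart_le_span :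
    (posPart K V : Set (PolyFun K V)) ⊆
      Ideal.span (LinearMap.range (SymmetricAlgebra.ι K (Module.Dual K V)) : Set (PolyFun K V)) := by
  have key : ∀ f : PolyFun K V, f - algebraMap K _ (SymmetricAlgebra.algebraMapInv f) ∈
      Ideal.span (LinearMap.range (SymmetricAlgebra.ι K (Module.Dual K V)) : Set (PolyFun K V)) := by
    intro f
    induction f using SymmetricAlgebra.induction with
    | algebraMap r => rw [AlgHom.commutes]; simp
    | ι x =>
      rw [SymmetricAlgebra.algebraMapInv_ι, map_zero, sub_zero]
      exact Ideal.subset_span ⟨x, rfl⟩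
    | mul a b ha hb =>
      have h := add_mem (Ideal.mul_mem_left _ b ha)
        (Ideal.mul_mem_left _ (algebraMap K _ (SymmetricAlgebra.algebraMapInv a)) hb)
      convert h using 1
      rw [map_mul, map_mul]; ring
    | add a b ha hb =>
      have h := add_mem ha hb
      convert h using 1
      rw [map_add, map_add]; ring
  intro f hf
  have h := key f
  rwa [show SymmetricAlgebra.algebraMapInv f = 0 from hf, map_zero, sub_zero] at h

lemma span_homog (n : ℕ) :
    Ideal.span (LinearMap.range (SymmetricAlgebra.ι K (Module.Dual K V)) : Set (PolyFun K V)) ^ n ≤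
      Ideal.span (homog K V n : Set (PolyFun K V)) := by
  induction n with
  | zero =>
    rw [pow_zero, Ideal.one_eq_top, top_le_iff, Ideal.eq_top_iff_one]
    refine Ideal.subset_span ?_
    rw [homog, pow_zero]
    exact Submodule.mem_one.2 ⟨1, map_one _⟩
  | succ n ih =>
    rw [pow_succ]
    refine le_trans (Ideal.mul_mono_left ih) ?_
    rw [Ideal.span_mul_span', Ideal.span_le]
    rintro _ ⟨a, ha, b, hb, rfl⟩
    refine Ideal.subset_span ?_
    rw [homog, pow_succ]
    exact Submodule.mul_mem_mul ha hb

lemma iSup_homog : ⨆ n, homog K V n = ⊤ := by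
  refine Submodule.eq_top_iff'.2 fun f => ?_
  induction f using SymmetricAlgebra.induction with
  | algebraMap r =>
    refine Submodule.mem_iSup_of_mem 0 ?_
    rw [homog, pow_zero]
    exact Submodule.mem_one.2 ⟨r, rfl⟩
  | ι x =>
    refine Submodule.mem_iSup_of_mem 1 ?_
    rw [homog, pow_one]
    exact ⟨x, rfl⟩
  | mul a b ha hb =>
    have h := Submodule.mul_mem_mul ha hb
    refine Submodule.mul_le.2 ?_ h
    intro a ha b hb
    induction ha using Submodule.iSup_induction' with
    | zero => rw [zero_mul]; exact zero_mem _
    | add x y _ _ hx hy => rw [add_mul]; exact add_mem hx hy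
    | mem i a ha =>
      induction hb using Submodule.iSup_induction' with
      | zero => rw [mul_zero]; exact zero_mem _
      | add x y _ _ hx hy => rw [mul_add]; exact add_mem hx hy
      | mem j b hb =>
        refine Submodule.mem_iSup_of_mem (i + j) ?_
        rw [homog, pow_add]
        exact Submodule.mul_mem_mul ha hb
  | add a b ha hb => exact add_mem ha hb


lemma iSup_coinvariantsHomog (G : Subgroup (V ≃ₗ[K] V)) : ⨆ n, coinvariantsHomog G n = ⊤ := by
  unfold coinvariantsHomog
  rw [← Submodule.map_iSup, iSup_homog, Submodule.map_top, LinearMap.range_eq_top]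
  exact Ideal.Quotient.mkₐ_surjective K _

variable [FiniteDimensional K V]

/-- Large powers of the maximal ideal at the origin lie in the ideal of coinvariants. -/
lemma exists_posPart_pow_le (G : Subgroup (V ≃ₗ[K] V)) [Finite G] :
    ∃ n, posPart K V ^ n ≤ (coinvariantIdeal G).restrictScalars K := by
  obtain ⟨n, hn⟩ := exists_coinvariantsHomog_eq_bot G
  refine ⟨n, ?_⟩
  have h1 : Ideal.span (homog K V n : Set (PolyFun K V)) ≤ coinvariantIdeal G := by
    refine Ideal.span_le.2 fun f hf => ?_
    have h2 : Ideal.Quotient.mk (coinvariantIdeal G) f ∈ coinvariantsHomog G n := ⟨f, hf, rfl⟩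
    rw [hn n le_rfl] at h2
    exact Ideal.Quotient.eq_zero_iff_mem.1 h2
  have h3 : ∀ m, posPart K V ^ m ≤ ((Ideal.span (LinearMap.range
      (SymmetricAlgebra.ι K (Module.Dual K V)) : Set (PolyFun K V))) ^ m).restrictScalars K := by
    intro m
    induction m with
    | zero => intro x _; simp
    | succ m ih =>
      rw [pow_succ, pow_succ, Submodule.mul_le]
      intro a ha b hb
      exact Ideal.mul_mem_mul (ih ha) (posPart_le_span hb)
  exact fun f hf => h1 (span_homog n (h3 n hf))

instance finite_homog (n : ℕ) : FiniteDimensional K (homog K V n) := by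
  have h : (homog K V n).FG := by
    rw [homog]
    refine Submodule.FG.pow ?_ n
    rw [LinearMap.range_eq_map]
    exact Module.Finite.fg_top.map _
  exact Module.Finite.of_fg h

instance finite_coinvariantsHomog (G : Subgroup (V ≃ₗ[K] V)) (n : ℕ) :
    FiniteDimensional K (coinvariantsHomog G n) := by
  unfold coinvariantsHomog
  infer_instance

instance finite_coinvariants (G : Subgroup (V ≃ₗ[K] V)) [Finite G] :
    FiniteDimensional K (Coinvariants G) := by
  obtain ⟨N, hN⟩ := exists_coinvariantsHomog_eq_bot G
  have h : ⨆ n : Fin N, coinvariantsHomog G n = ⊤ := by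
    rw [← top_le_iff, ← iSup_coinvariantsHomog G]
    refine iSup_le fun n => ?_
    by_cases hn : n < N
    · exact le_iSup (fun n : Fin N => coinvariantsHomog G n) ⟨n, hn⟩
    · rw [hN n (not_lt.1 hn)]; exact bot_le
  have h1 : FiniteDimensional K (⨆ n : Fin N, coinvariantsHomog G n : Submodule K (Coinvariants G)) :=
    inferInstance
  rw [h] at h1
  exact Module.Finite.equiv Submodule.topEquiv

/-- Invariants of a finite group give an integral extension, and `S` is of finite type. This
supplies the finite generation that Nakayama's lemma requires. -/
lemma finite_over_invariantAlgebra (G : Subgroup (V ≃ₗ[K] V)) [Finite G] :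
    Module.Finite (invariantAlgebra G) (PolyFun K V) := by
  let _ : MulSemiringAction G (PolyFun K V) :=
    { smul := fun g f => polyAct (g : V ≃ₗ[K] V) f
      one_smul := polyAct_one_apply
      mul_smul := fun g h f => polyAct_mul_apply _ _ f
      smul_zero := fun g => map_zero _
      smul_add := fun g => map_add _
      smul_one := fun g => map_one _
      smul_mul := fun g => map_mul _ }
  have : Algebra.IsInvariant (invariantAlgebra G) (PolyFun K V) G :=
    ⟨fun b hb => ⟨⟨b, fun g hg => hb ⟨g, hg⟩⟩, rfl⟩⟩
  have h1 : Algebra.IsIntegral (invariantAlgebra G) (PolyFun K V) :=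
    Algebra.IsInvariant.isIntegral _ _ G
  have h2 : Algebra.FiniteType K (PolyFun K V) :=
    Algebra.FiniteType.equiv inferInstance
      (SymmetricAlgebra.equivMvPolynomial (Module.finBasis K (Module.Dual K V))).symm
  have h3 : Algebra.FiniteType (invariantAlgebra G) (PolyFun K V) :=
    Algebra.FiniteType.of_restrictScalars_finiteType K _ _
  exact Algebra.finite_iff_isIntegral_and_finiteType.2 ⟨h1, h3⟩

/-- If elements of `G` induce distinct maps on the `N`-invariants, there are at most
`dim (S_G)^N` of them. -/
lemma card_le_of_span_coinvariants [CharZero K] {N G : Subgroup (V ≃ₗ[K] V)} [Finite G] (hN : N ≤ G)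
    {X ι : Type*} [Fintype X] [Fintype ι] (g : X → (V ≃ₗ[K] V)) (hg : ∀ x, g x ∈ G)
    (hinj : ∀ x y, (∀ f ∈ invariantAlgebra N, polyAct (g x) f = polyAct (g y) f) → x = y)
    (p : ι → PolyFun K V) (hp : ∀ i, p i ∈ invariantAlgebra N)
    (hspan : ∀ f ∈ invariantAlgebra N, ∃ k : ι → K,
      f - ∑ i, k i • p i ∈ coinvariantIdeal G) :
    Fintype.card X ≤ Fintype.card ι := by
  classical
  have : Finite N := Finite.of_injective _ (Subgroup.inclusion_injective hN)
  have := Fintype.ofFinite N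
  have hGN : ∀ f ∈ invariantAlgebra G, f ∈ invariantAlgebra N := fun f hf x hx => hf x (hN hx)
  have := finite_over_invariantAlgebra G
  -- The Reynolds operator of `N` is linear over the `G`-invariants; this makes `S^N`, its range, a
  -- finite module over them.
  let T : PolyFun K V →ₗ[invariantAlgebra G] PolyFun K V :=
    { toFun := reynolds N
      map_add' := map_add _
      map_smul' := fun r f => by
        rw [Subalgebra.smul_def, smul_eq_mul, reynolds_mul N (hGN _ r.2), Subalgebra.smul_def,
          smul_eq_mul, RingHom.id_apply] }
  have hT : ∀ f, f ∈ LinearMap.range T ↔ f ∈ invariantAlgebra N := by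
    refine fun f => ⟨?_, fun hf => ⟨f, reynolds_of_mem N hf⟩⟩
    rintro ⟨f, rfl⟩
    exact reynolds_mem N f
  let Q : Submodule (invariantAlgebra G) (PolyFun K V) := Submodule.span _ (Set.range p)
  let I : Ideal (invariantAlgebra G) :=
    RingHom.ker ((SymmetricAlgebra.algebraMapInv).comp (invariantAlgebra G).val)
  -- Averaging over `N` moves an element of the ideal of `S` generated by `S^G_+` into `S^G_+ ·
  -- S^N`. Hence the `p i` span `S^N` modulo `I • S^N`, the hypothesis of Nakayama's lemma.
  have hI : ∀ f ∈ coinvariantIdeal G, reynolds N f ∈ I • LinearMap.range T := by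
    have key : ∀ f ∈ coinvariantIdeal G, ∀ a, reynolds N (a * f) ∈ I • LinearMap.range T := by
      intro f hf
      induction hf using Submodule.span_induction with
      | mem f hf =>
        intro a
        obtain ⟨hf1, hf2⟩ := mem_invariantsPos.1 hf
        rw [mul_comm, reynolds_mul N (hGN f hf1)]
        exact Submodule.smul_mem_smul (r := (⟨f, hf1⟩ : invariantAlgebra G)) hf2 ⟨a, rfl⟩
      | zero => intro a; rw [mul_zero, map_zero]; exact zero_mem _
      | add x y _ _ hx hy => intro a; rw [mul_add, map_add]; exact add_mem (hx a) (hy a)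
      | smul b x _ hx => intro a; rw [smul_eq_mul, ← mul_assoc]; exact hx _
    intro f hf
    simpa using key f hf 1
  have hle : LinearMap.range T ≤ Q ⊔ I • LinearMap.range T := by
    intro f hf
    have hf' := (hT f).1 hf
    obtain ⟨k, hk⟩ := hspan f hf'
    have h1 := hI _ hk
    have h2 : ∑ i, k i • p i ∈ invariantAlgebra N :=
      sum_mem fun i _ => Subalgebra.smul_mem _ (hp i) _
    rw [reynolds_of_mem N (sub_mem hf' h2)] at h1
    have h4 : ∑ i, k i • p i ∈ Q := by
      refine sum_mem fun i _ => ?_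
      have h3 : k i • p i = (algebraMap K (invariantAlgebra G) (k i)) • p i := by
        rw [algebraMap_smul]
      rw [h3]
      exact Submodule.smul_mem _ _ (Submodule.subset_span ⟨i, rfl⟩)
    have h5 := Submodule.add_mem_sup h4 h1
    rwa [add_sub_cancel] at h5
  have hfg : (LinearMap.range T).FG := by
    rw [LinearMap.range_eq_map]
    exact Module.Finite.fg_top.map _
  obtain ⟨c, hcI, hc⟩ := exists_sub_one_mem_and_smul_mem I _ Q hfg hle
  -- Nakayama is applied without a grading, hence the denominator `c`; its constant term is `1`.
  have hc0 : (c : PolyFun K V) ≠ 0 := by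
    intro h0
    have h1 : SymmetricAlgebra.algebraMapInv ((c - 1 : invariantAlgebra G) : PolyFun K V) = (0 : K) :=
      hcI
    rw [AddSubgroupClass.coe_sub, h0, OneMemClass.coe_one, map_sub, map_zero, map_one] at h1
    simp at h1
  -- The characters are the restrictions of the `g x` to `S^N`. They agree on `c` and on the
  -- coefficients because those are `G`-invariant.
  refine card_le_card_of_span
    (fun x => ((polyAct (g x)).comp (invariantAlgebra N).val : invariantAlgebra N →+* PolyFun K V))
    (fun x y hxy => hinj x y fun f hf => DFunLike.congr_fun hxy ⟨f, hf⟩)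
    (fun i => ⟨p i, hp i⟩) ⟨c, hGN c c.2⟩ c hc0 (fun x => c.2 _ (hg x)) ?_
  intro b
  have h1 := hc b ((hT b).2 b.2)
  rw [Submodule.mem_span_range_iff_exists_fun] at h1
  obtain ⟨r, hr⟩ := h1
  refine ⟨fun i => ⟨r i, hGN _ (r i).2⟩, fun x y i => ?_, Subtype.ext ?_⟩
  · exact ((r i).2 _ (hg x)).trans ((r i).2 _ (hg y)).symm
  · rw [AddSubmonoidClass.coe_finsetSum]
    exact hr.symm

end Finiteness

/-! ### Homotheties, graded traces and fake degrees as averages -/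

section Traces

variable {K : Type u} [Field K] {V : Type v} [AddCommGroup V] [Module K V]

variable (V) in
/-- The homothety of `V` that multiplies linear forms by `t`. -/
def scaling (t : Kˣ) : V ≃ₗ[K] V := LinearEquiv.smulOfUnit t⁻¹

lemma scaling_inv_apply (t : Kˣ) (x : V) : ((scaling V t)⁻¹ : V ≃ₗ[K] V) x = (t : K) • x := by
  rw [LinearEquiv.coe_inv, LinearEquiv.symm_apply_eq]
  change x = (t⁻¹ : Kˣ) • ((t : K) • x)
  rw [Units.smul_def, smul_smul, Units.inv_mul, one_smul]

lemma scaling_comm (t : Kˣ) (g : V ≃ₗ[K] V) : scaling V t * g = g * scaling V t := by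
  ext x
  exact (map_smul g ((t⁻¹ : Kˣ) : K) x).symm

lemma scaling_mem_normalizer (t : Kˣ) (G : Subgroup (V ≃ₗ[K] V)) :
    scaling V t ∈ Subgroup.normalizer (G : Set (V ≃ₗ[K] V)) := by
  rw [Subgroup.mem_normalizer_iff]
  intro h
  rw [scaling_comm, mul_inv_cancel_right]

/-- The central homotheties carry the grading, so a generating function of graded traces becomes the
trace of a single element of the normaliser. -/
lemma polyAct_scaling (t : Kˣ) (n : ℕ) {f : PolyFun K V} (hf : f ∈ homog K V n) :
    polyAct (scaling V t) f = (t : K) ^ n • f := by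
  induction n generalizing f with
  | zero =>
    rw [homog, pow_zero] at hf
    obtain ⟨r, rfl⟩ := Submodule.mem_one.1 hf
    rw [AlgHom.commutes, pow_zero, one_smul]
  | succ n ih =>
    rw [homog, pow_succ] at hf
    induction hf using Submodule.mul_induction_on' with
    | mem_mul_mem a ha b hb =>
      obtain ⟨φ, rfl⟩ := hb
      have h : φ ∘ₗ ((scaling V t)⁻¹ : V ≃ₗ[K] V).toLinearMap = (t : K) • φ := by
        ext x
        rw [LinearMap.comp_apply, LinearEquiv.coe_coe, scaling_inv_apply, map_smul,
          LinearMap.smul_apply]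
      rw [map_mul, ih ha, polyAct_ι, h, map_smul, smul_mul_smul_comm, pow_succ]
    | add a _ b _ ha hb => rw [map_add, ha, hb, smul_add]

open Classical in
/-- The trace on the coinvariant algebra of an element of the normaliser. -/
def coinvariantTrace (G : Subgroup (V ≃ₗ[K] V)) (h : V ≃ₗ[K] V) : K :=
  -- The value `0` off the normaliser makes this a function on all of `GL(V)`, so equal group
  -- elements can be exchanged without carrying membership proofs along.
  if hh : h ∈ Subgroup.normalizer (G : Set (V ≃ₗ[K] V)) then
    LinearMap.trace K (Coinvariants G) (coinvariantsAct hh).toLinearMap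
  else 0

lemma coinvariantTrace_eq {G : Subgroup (V ≃ₗ[K] V)} {h : V ≃ₗ[K] V}
    (hh : h ∈ Subgroup.normalizer (G : Set (V ≃ₗ[K] V))) :
    coinvariantTrace G h = LinearMap.trace K (Coinvariants G) (coinvariantsAct hh).toLinearMap :=
  dif_pos hh

lemma coinvariantsAct_scaling {G : Subgroup (V ≃ₗ[K] V)} (t : Kˣ) (n : ℕ) {x : Coinvariants G}
    (hx : x ∈ coinvariantsHomog G n) :
    coinvariantsAct (scaling_mem_normalizer t G) x = (t : K) ^ n • x := by
  obtain ⟨f, hf, rfl⟩ := hx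
  rw [AlgHom.toLinearMap_apply, ← map_smul, ← polyAct_scaling t n hf]
  rfl

/-- The homothety `t = 2` has eigenvalue `2^n` in degree `n`, and these are distinct in
characteristic zero. No separate proof that the ideal of coinvariants is homogeneous is needed. -/
lemma iSupIndep_coinvariantsHomog [CharZero K] (G : Subgroup (V ≃ₗ[K] V)) :
    iSupIndep (coinvariantsHomog G) := by
  let t : Kˣ := Units.mk0 2 two_ne_zero
  have h := (Module.End.eigenspaces_iSupIndep
    ((coinvariantsAct (scaling_mem_normalizer t G)).toLinearMap : Module.End K (Coinvariants G))).comp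
    (f := fun n : ℕ => (2 : K) ^ n) (fun m n hmn => by
      have : ((2 ^ m : ℕ) : K) = ((2 ^ n : ℕ) : K) := by push_cast; exact hmn
      exact Nat.pow_right_injective le_rfl (Nat.cast_injective this))
  refine h.mono fun n x hx => ?_
  rw [Function.comp_apply, Module.End.mem_eigenspace_iff]
  exact coinvariantsAct_scaling t n hx

/-- The trace of an endomorphism that acts on the members of a direct sum decomposition by
multiples of given endomorphisms. -/
lemma trace_eq_sum_mul_trace {Y ι : Type*} [AddCommGroup Y] [Module K Y] [FiniteDimensional K Y]
    [Fintype ι] [DecidableEq ι] {p : ι → Submodule K Y} (hp : DirectSum.IsInternal p)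
    (f : Y →ₗ[K] Y) (c : ι → K) (g : ∀ i, p i →ₗ[K] p i)
    (h : ∀ i (x : p i), f x = c i • (g i x : Y)) :
    LinearMap.trace K Y f = ∑ i, LinearMap.trace K (p i) (g i) * c i := by
  have hmaps : ∀ i, Set.MapsTo f (p i) (p i) := by
    intro i x hx
    have h1 := h i ⟨x, hx⟩
    change f x = _ at h1
    rw [h1]
    exact Submodule.smul_mem _ _ (g i ⟨x, hx⟩).2
  rw [LinearMap.trace_eq_sum_trace_restrict hp hmaps]
  refine Finset.sum_congr rfl fun i _ => ?_
  have : f.restrict (hmaps i) = c i • g i := LinearMap.ext fun x => Subtype.ext (h i x)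
  rw [this, map_smul, smul_eq_mul, mul_comm]

variable {G A : Subgroup (V ≃ₗ[K] V)}

/-- On the component of degree `n` the homothety is the scalar `t^n`, so the total trace is the
generating function of the graded traces. -/
lemma coinvariantTrace_mul_scaling [CharZero K] [FiniteDimensional K V] [Finite G]
    (hA : A ≤ Subgroup.normalizer (G : Set (V ≃ₗ[K] V))) (a : A) (t : Kˣ) {N : ℕ}
    (hN : ∀ n, N ≤ n → coinvariantsHomog G n = ⊥) :
    coinvariantTrace G ((a : V ≃ₗ[K] V) * scaling V t) =
      ∑ n ∈ Finset.range N, LinearMap.trace K _ (coinvariantsHomogRep hA n a) * (t : K) ^ n := by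
  have htop : ⨆ n : Fin N, coinvariantsHomog G n = ⊤ := by
    rw [← top_le_iff, ← iSup_coinvariantsHomog G]
    refine iSup_le fun n => ?_
    by_cases hn : n < N
    · exact le_iSup (fun n : Fin N => coinvariantsHomog G n) ⟨n, hn⟩
    · rw [hN n (not_lt.1 hn)]; exact bot_le
  have hint : DirectSum.IsInternal fun n : Fin N => coinvariantsHomog G n :=
    DirectSum.isInternal_submodule_of_iSupIndep_of_iSup_eq_top
      ((iSupIndep_coinvariantsHomog G).comp Fin.val_injective) htop
  have hmem : (a : V ≃ₗ[K] V) * scaling V t ∈ Subgroup.normalizer (G : Set (V ≃ₗ[K] V)) :=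
    mul_mem (hA a.2) (scaling_mem_normalizer t G)
  have hact : ∀ n (x : Coinvariants G), x ∈ coinvariantsHomog G n →
      coinvariantsAct hmem x = (t : K) ^ n • coinvariantsRep hA a x := by
    intro n x hx
    have h1 : coinvariantsAct hmem x =
        coinvariantsRep hA a (coinvariantsAct (scaling_mem_normalizer t G) x) := by
      obtain ⟨f, rfl⟩ := Ideal.Quotient.mk_surjective x
      change Ideal.Quotient.mk _ (polyAct _ f) = Ideal.Quotient.mk _ (polyAct _ (polyAct _ f))
      rw [polyAct_mul_apply]
    rw [h1, coinvariantsAct_scaling t n hx, map_smul]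
  rw [coinvariantTrace_eq hmem, Finset.sum_range]
  exact trace_eq_sum_mul_trace hint _ (fun n => (t : K) ^ (n : ℕ))
    (fun n => coinvariantsHomogRep hA n a) fun n x => hact n x x.2

/-- The trace on the invariants of a normal subgroup is an average of traces. -/
lemma trace_toInvariants [CharZero K] {A Y : Type*} [Group A] [AddCommGroup Y] [Module K Y]
    [FiniteDimensional K Y] (τ : Representation K A Y) (H : Subgroup A) [H.Normal] [Fintype H]
    (a : A) :
    LinearMap.trace K _ (τ.toInvariants H a) =
      (Fintype.card H : K)⁻¹ * ∑ h : H, LinearMap.trace K Y (τ (h * a)) := by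
  have hcard : (Fintype.card H : K) ≠ 0 := Nat.cast_ne_zero.2 Fintype.card_ne_zero
  let T : Y →ₗ[K] Y := (Fintype.card H : K)⁻¹ • ∑ h : H, τ (h * a)
  have hT : ∀ y, T y = (Fintype.card H : K)⁻¹ • ∑ h : H, τ h (τ a y) := fun y => by
    simp [T, map_mul]
  have hmem : ∀ y, T y ∈ Representation.invariants (τ.comp H.subtype) := by
    intro y g
    rw [hT, map_smul, map_sum]
    congr 1
    refine Fintype.sum_equiv (Equiv.mulLeft g) _ _ fun h => ?_
    change τ g (τ h _) = τ ((g * h : H) : A) _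
    rw [Subgroup.coe_mul, map_mul]
    rfl
  -- The average `T` maps all of `Y` into the invariants and agrees with `a` there, so its trace on
  -- `Y` is the trace sought.
  have hres : τ.toInvariants H a = T.restrict fun x _ => hmem x := by
    refine LinearMap.ext fun x => Subtype.ext ?_
    change τ a x = T x
    have hx : ∀ h : H, τ h (τ a x) = τ a x := fun h =>
      (Representation.toInvariants τ H a x).2 h
    rw [hT, Finset.sum_congr rfl fun h _ => hx h, Finset.sum_const, Finset.card_univ,
      ← Nat.cast_smul_eq_nsmul K, smul_smul, inv_mul_cancel₀ hcard, one_smul]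
  rw [hres, LinearMap.trace_restrict_eq_of_forall_mem _ T hmem]
  simp [T]

variable {M : Type w} [AddCommGroup M] [Module K M]

/-- Averaging projects onto the `G`-invariants; the trace is multiplicative on tensor products, and
on `M^*` it is the trace of the inverse on `M`. -/
lemma fakeDegreeCoeff_eq_sum [CharZero K] [FiniteDimensional K V] [Fintype G]
    [FiniteDimensional K M] (hGA : G ≤ A)
    (hA : A ≤ Subgroup.normalizer (G : Set (V ≃ₗ[K] V))) (ρ : Representation K A M) (γ : A) (n : ℕ) :
    fakeDegreeCoeff hGA hA ρ γ n = (Fintype.card G : K)⁻¹ * ∑ g : G,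
      LinearMap.trace K _ (coinvariantsHomogRep hA n (Subgroup.inclusion hGA g * γ)) *
        LinearMap.trace K M (ρ (Subgroup.inclusion hGA g * γ)⁻¹) := by
  have : (G.subgroupOf A).Normal := (Subgroup.normal_subgroupOf_iff_le_normalizer hGA).2 hA
  let e : G.subgroupOf A ≃* G := Subgroup.subgroupOfEquivOfLe hGA
  let _ : Fintype (G.subgroupOf A) := Fintype.ofEquiv G e.symm.toEquiv
  unfold fakeDegreeCoeff
  rw [trace_toInvariants, Fintype.card_congr e.toEquiv]
  congr 1
  refine Fintype.sum_equiv e.toEquiv _ _ fun h => ?_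
  have h1 : Subgroup.inclusion hGA (e.toEquiv h) = (h : A) := rfl
  rw [h1, Representation.tprod_apply, LinearMap.trace_tensorProduct', Representation.dual_apply]
  congr 1
  exact LinearMap.trace_transpose' _

/-- The value of a fake degree as an average over the group. -/
lemma eval_fakeDegree [CharZero K] [FiniteDimensional K V] [Fintype G]
    [FiniteDimensional K M] (hGA : G ≤ A)
    (hA : A ≤ Subgroup.normalizer (G : Set (V ≃ₗ[K] V))) (ρ : Representation K A M) (γ : A)
    (t : Kˣ) :
    (fakeDegree hGA hA ρ γ).eval (t : K) = (Fintype.card G : K)⁻¹ * ∑ g : G,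
      coinvariantTrace G (g * γ * scaling V t) *
        LinearMap.trace K M (ρ (Subgroup.inclusion hGA g * γ)⁻¹) := by
  obtain ⟨N, hN⟩ := exists_coinvariantsHomog_eq_bot G
  have hdeg : (fakeDegree hGA hA ρ γ).natDegree ≤ N := by
    rw [natDegree_le_iff_coeff_eq_zero]
    intro m hm
    rw [coeff_fakeDegree]
    have : Subsingleton (coinvariantsHomog G m) := by
      rw [hN m hm.le]; infer_instance
    have : Subsingleton (coinvariantsHomog G m ⊗[K] Module.Dual K M) :=
      inferInstance
    unfold fakeDegreeCoeff
    exact trace_eq_zero_of_subsingleton Subtype.val_injective.subsingleton _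
  rw [eval_eq_sum_range' (Nat.lt_succ_of_le hdeg), Nat.succ_eq_add_one]
  simp only [coeff_fakeDegree, fakeDegreeCoeff_eq_sum, mul_assoc, Finset.sum_mul]
  rw [← Finset.mul_sum, Finset.sum_comm]
  congr 1
  refine Finset.sum_congr rfl fun g _ => ?_
  -- The bound is `N + 1` because evaluating a polynomial of degree at most `N` sums over `range (N
  -- + 1)`.
  have h1 := coinvariantTrace_mul_scaling hA (Subgroup.inclusion hGA g * γ) t (N := N + 1)
    fun n hn => hN n (by omega)
  rw [← mul_assoc, show (g : V ≃ₗ[K] V) * γ = (Subgroup.inclusion hGA g * γ : A) from rfl, h1,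
    Finset.sum_mul]
  exact Finset.sum_congr rfl fun n _ => by ring

/-- Traces are compatible with injective intertwining maps onto a subspace containing the image. -/
lemma trace_eq_of_intertwine {X Y : Type*} [AddCommGroup X] [Module K X] [AddCommGroup Y]
    [Module K Y] [FiniteDimensional K Y] (Φ : X →ₗ[K] Y) (hΦ : Function.Injective Φ)
    (τ : X →ₗ[K] X) (T : Y →ₗ[K] Y) (h : T ∘ₗ Φ = Φ ∘ₗ τ) (hr : ∀ y, T y ∈ LinearMap.range Φ) :
    LinearMap.trace K Y T = LinearMap.trace K X τ := by
  rw [← LinearMap.trace_restrict_eq_of_forall_mem _ T hr,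
    ← LinearMap.trace_conj' τ (LinearEquiv.ofInjective Φ hΦ)]
  congr 1
  refine LinearMap.ext fun y => ?_
  obtain ⟨x, rfl⟩ := (LinearEquiv.ofInjective Φ hΦ).surjective y
  rw [LinearEquiv.conj_apply_apply, LinearEquiv.symm_apply_apply]
  exact Subtype.ext (DFunLike.congr_fun h x)

/-- The trace of a tensor product of endomorphisms. -/
lemma trace_piTensorProduct_map {ι : Type*} [Fintype ι] {X : ι → Type*} [∀ i, AddCommGroup (X i)]
    [∀ i, Module K (X i)] [∀ i, FiniteDimensional K (X i)] (f : ∀ i, X i →ₗ[K] X i) :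
    LinearMap.trace K (⨂[K] i, X i) (PiTensorProduct.map f) =
      ∏ i, LinearMap.trace K (X i) (f i) := by
  classical
  let b := fun i => Module.finBasis K (X i)
  rw [LinearMap.trace_eq_matrix_trace K (Basis.piTensorProduct b)]
  simp only [fun i => LinearMap.trace_eq_matrix_trace K (b i) (f i), Matrix.trace, Matrix.diag]
  rw [Finset.prod_univ_sum, Fintype.piFinset_univ]
  refine Finset.sum_congr rfl fun p _ => ?_
  rw [LinearMap.toMatrix_apply, Basis.piTensorProduct_apply, PiTensorProduct.map_tprod,
    Basis.piTensorProduct_repr_tprod_apply]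
  exact Finset.prod_congr rfl fun i _ => (LinearMap.toMatrix_apply _ _ _ _ _).symm

end Traces

/-! ### The image of `G` in `GL(E)` as a product of reflection groups -/

section Components

variable {K : Type u} [Field K] {V : Type v} [AddCommGroup V] [Module K V]

lemma disjoint_homog [CharZero K] {m n : ℕ} (hmn : m ≠ n) : homog K V m ⊓ homog K V n = ⊥ := by
  rw [eq_bot_iff]
  intro f hf
  let t : Kˣ := Units.mk0 2 two_ne_zero
  have h1 := (polyAct_scaling t m hf.1).symm.trans (polyAct_scaling t n hf.2)
  rw [← sub_eq_zero, ← sub_smul] at h1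
  refine (smul_eq_zero.1 h1).resolve_left fun h => hmn ?_
  have h2 : ((2 ^ m : ℕ) : K) = ((2 ^ n : ℕ) : K) := by push_cast; exact sub_eq_zero.1 h
  exact Nat.pow_right_injective le_rfl (Nat.cast_injective h2)

section DualHom

variable {A : Subgroup (V ≃ₗ[K] V)} {W : Submodule K (PolyFun K V)}
  (hW : ∀ g ∈ A, ∀ f ∈ W, polyAct g f ∈ W)

lemma dualHom_apply (g : A) (φ : DualSpace W) (u : W) :
    dualHom A W hW g φ u = φ ⟨polyAct ((g⁻¹ : A) : V ≃ₗ[K] V) u, hW _ (g⁻¹).2 u u.2⟩ :=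
  rfl

lemma dualHom_eq_one_iff (g : A) :
    dualHom A W hW g = 1 ↔ ∀ u ∈ W, polyAct (g : V ≃ₗ[K] V) u = u := by
  rw [← inv_inj, ← map_inv, inv_one]
  constructor
  · intro h u hu
    have h1 : (⟨polyAct (g : V ≃ₗ[K] V) u, hW _ g.2 u hu⟩ : W) = ⟨u, hu⟩ := by
      rw [← sub_eq_zero, ← Module.forall_dual_apply_eq_zero_iff K]
      intro φ
      have h2 := DFunLike.congr_fun (DFunLike.congr_fun h φ) ⟨u, hu⟩
      rw [dualHom_apply] at h2
      simp only [inv_inv] at h2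
      rw [map_sub, sub_eq_zero]
      exact h2
    exact congrArg Subtype.val h1
  · intro h
    refine LinearEquiv.ext fun φ => LinearMap.ext fun u => ?_
    rw [dualHom_apply]
    simp only [inv_inv]
    exact congrArg φ (Subtype.ext (h u u.2))

/-- The rank of `g - 1` on the dual of `W` is that of `g⁻¹ - 1` on `W`. -/
lemma finrank_quotient_ker_dualHom [FiniteDimensional K W] (g : A) :
    Module.finrank K (DualSpace W ⧸
      LinearMap.ker ((dualHom A W hW g).toLinearMap - LinearMap.id)) =
    Module.finrank K
      (W.map ((polyAct ((g⁻¹ : A) : V ≃ₗ[K] V)).toLinearMap - LinearMap.id)) := by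
  let δ : W →ₗ[K] W := (polyAct ((g⁻¹ : A) : V ≃ₗ[K] V)).toLinearMap.restrict
    (hW _ (g⁻¹).2) - LinearMap.id
  have h1 : (dualHom A W hW g).toLinearMap - LinearMap.id = δ.dualMap := by
    refine LinearMap.ext fun φ => LinearMap.ext fun u => ?_
    change φ _ - φ u = φ (_ - u)
    rw [map_sub]
    rfl
  have h2 : W.map ((polyAct ((g⁻¹ : A) : V ≃ₗ[K] V)).toLinearMap - LinearMap.id) =
      (LinearMap.range δ).map W.subtype := by
    rw [← LinearMap.range_comp]
    ext f
    constructor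
    · rintro ⟨u, hu, rfl⟩
      exact ⟨⟨u, hu⟩, rfl⟩
    · rintro ⟨u, rfl⟩
      exact ⟨u, u.2, rfl⟩
  rw [h1, h2, (LinearMap.quotKerEquivRange _).finrank_eq,
    LinearMap.finrank_range_dualMap_eq_finrank_range]
  exact (Submodule.equivMapOfInjective W.subtype W.injective_subtype _).finrank_eq

end DualHom

/-- Only the image of `A` is generated by reflections, so an induction over generators must take
place in `B`; it descends to `A` because `Q` contains the kernel. -/
lemma eq_top_of_closure {A B : Type*} [Group A] [Group B] (τ : A →* B) (r : B → Prop)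
    (hr : Subgroup.closure {b | b ∈ τ.range ∧ r b} = τ.range) (Q : Subgroup A) (hker : τ.ker ≤ Q)
    (hQ : ∀ a, r (τ a) → a ∈ Q) : Q = ⊤ := by
  have h : τ.range ≤ Q.map τ := by
    rw [← hr, Subgroup.closure_le]
    rintro _ ⟨⟨a, rfl⟩, ha⟩
    exact ⟨a, hQ a ha, rfl⟩
  refine eq_top_iff.2 fun a _ => ?_
  obtain ⟨q, hq, hqa⟩ := h ⟨a, rfl⟩
  have h1 : a * q⁻¹ ∈ Q := hker (by rw [MonoidHom.mem_ker, map_mul, map_inv, hqa, mul_inv_cancel])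
  simpa using mul_mem h1 hq

lemma closure_range_eq {A B C : Type*} [Group A] [Group B] [Group C] (τ : A →* B) (r : B → Prop)
    (hr : Subgroup.closure {b | b ∈ τ.range ∧ r b} = τ.range) (ψ : A →* C) (r' : C → Prop)
    (hker : ∀ a, τ a = 1 → ψ a = 1) (hrr' : ∀ a, r (τ a) → ψ a = 1 ∨ r' (ψ a)) :
    Subgroup.closure {c | c ∈ ψ.range ∧ r' c} = ψ.range := by
  refine le_antisymm ((Subgroup.closure_le _).2 fun x hx => hx.1) ?_
  have htop := eq_top_of_closure τ r hr
    ((Subgroup.closure {c | c ∈ ψ.range ∧ r' c}).comap ψ) ?_ ?_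
  · rintro _ ⟨a, rfl⟩
    exact Subgroup.mem_comap.1 (htop.ge (Subgroup.mem_top a))
  · intro a ha
    rw [Subgroup.mem_comap, hker a ha]
    exact one_mem _
  · intro a ha
    rw [Subgroup.mem_comap]
    rcases hrr' a ha with h | h
    · rw [h]; exact one_mem _
    · exact Subgroup.subset_closure ⟨⟨a, rfl⟩, h⟩

/-- A lift of a generator has at most one nontrivial coordinate. Deleting all coordinates but the
`i`-th thus leaves its image unchanged or gives `1`, so the range contains each factor. -/
lemma pi_surjective_of_closure {A B ι : Type*} {C : ι → Type*} [Group A] [Group B]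
    [∀ i, Group (C i)] [Finite ι] (τ : A →* B) (r : B → Prop)
    (hr : Subgroup.closure {b | b ∈ τ.range ∧ r b} = τ.range) (ψ : ∀ i, A →* C i)
    (hsurj : ∀ i, Function.Surjective (ψ i)) (hker : ∀ a, τ a = 1 → ∀ i, ψ i a = 1)
    (hs : ∀ a, r (τ a) → ∀ i j, i ≠ j → ψ i a = 1 ∨ ψ j a = 1) :
    Function.Surjective (MonoidHom.pi ψ) := by
  classical
  rw [← MonoidHom.range_eq_top, eq_top_iff]
  intro x _
  refine Subgroup.pi_mem_of_mulSingle_mem x fun i => ?_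
  have htop := eq_top_of_closure τ r hr
    ((MonoidHom.pi ψ).range.comap ((MonoidHom.mulSingle C i).comp (ψ i))) ?_ ?_
  · obtain ⟨a, ha⟩ := hsurj i (x i)
    have h := Subgroup.mem_comap.1 (htop.ge (Subgroup.mem_top a))
    rwa [MonoidHom.comp_apply, ha] at h
  · intro a ha
    rw [Subgroup.mem_comap, MonoidHom.comp_apply, hker a ha, map_one]
    exact one_mem _
  · intro a ha
    rw [Subgroup.mem_comap, MonoidHom.comp_apply]
    by_cases hi : ψ i a = 1
    · rw [hi, map_one]; exact one_mem _
    · refine ⟨a, funext fun j => ?_⟩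
      rw [MonoidHom.mulSingle_apply, MonoidHom.pi_apply]
      by_cases hji : j = i
      · subst hji; rw [Pi.mulSingle_eq_same]
      · rw [Pi.mulSingle_eq_of_ne hji]
        exact (hs a ha j i hji).resolve_right hi

variable {G L : Subgroup (V ≃ₗ[K] V)} {U : Submodule K (PolyFun K V)}

instance finite_inf_homog [FiniteDimensional K V] (U : Submodule K (PolyFun K V)) (n : ℕ) :
    FiniteDimensional K (U ⊓ homog K V n : Submodule K (PolyFun K V)) :=
  Submodule.finiteDimensional_inf_right _ _

lemma IsStableComplement.finiteDimensional [FiniteDimensional K V] (hU : IsStableComplement L U)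
    (D : Finset ℕ) (hD : ∀ n, n ∉ D → U ⊓ homog K V n = ⊥) : FiniteDimensional K U := by
  have h : U = ⨆ n : D, U ⊓ homog K V n := by
    refine le_antisymm ?_ (iSup_le fun n => inf_le_left)
    conv_lhs => rw [hU.graded]
    refine iSup_le fun n => ?_
    by_cases hn : n ∈ D
    · exact le_iSup (fun n : D => U ⊓ homog K V n) ⟨n, hn⟩
    · rw [hD n hn]; exact bot_le
  rw [h]
  infer_instance

variable (hU : IsStableComplement L U) (hGL : G ≤ Subgroup.normalizer (L : Set (V ≃ₗ[K] V)))

/-- The homomorphism from `G` to its image in `GL(E_n)`. -/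
def componentRestrict (n : ℕ) : G →* componentImage hU n G :=
  ((componentHom hU n).comp (Subgroup.inclusion hGL)).codRestrict _ fun g =>
    ⟨_, Subgroup.mem_subgroupOf.2 g.2, rfl⟩

lemma coe_componentRestrict (n : ℕ) (g : G) :
    (componentRestrict hU hGL n g : Component U n ≃ₗ[K] Component U n) =
      componentHom hU n (Subgroup.inclusion hGL g) :=
  rfl

/-- The homomorphism from `G` to the product of its images in the groups `GL(E_n)`, `n ∈ D`. -/
def componentsHom (D : Finset ℕ) : G →* ∀ n : D, componentImage hU (n : ℕ) G :=
  MonoidHom.pi fun n => componentRestrict hU hGL n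

lemma componentRestrict_surjective (n : ℕ) : Function.Surjective (componentRestrict hU hGL n) := by
  rintro ⟨_, ⟨g, hg, rfl⟩⟩
  exact ⟨⟨g, Subgroup.mem_subgroupOf.1 hg⟩, rfl⟩

lemma componentRestrict_eq_one_iff (n : ℕ) (g : G) :
    componentRestrict hU hGL n g = 1 ↔
      ∀ u ∈ U ⊓ homog K V n, polyAct (g : V ≃ₗ[K] V) u = u := by
  rw [Subtype.ext_iff, coe_componentRestrict]
  exact dualHom_eq_one_iff _ _

lemma range_tangentHom_comp :
    ((tangentHom hU).comp (Subgroup.inclusion hGL)).range = tangentImage hU G := by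
  ext x
  constructor
  · rintro ⟨g, rfl⟩
    exact ⟨_, Subgroup.mem_subgroupOf.2 g.2, rfl⟩
  · rintro ⟨g, hg, rfl⟩
    exact ⟨⟨g, Subgroup.mem_subgroupOf.1 hg⟩, rfl⟩

lemma range_componentHom_comp (n : ℕ) :
    ((componentHom hU n).comp (Subgroup.inclusion hGL)).range = componentImage hU n G := by
  ext x
  constructor
  · rintro ⟨g, rfl⟩
    exact ⟨_, Subgroup.mem_subgroupOf.2 g.2, rfl⟩
  · rintro ⟨g, hg, rfl⟩
    exact ⟨⟨g, Subgroup.mem_subgroupOf.1 hg⟩, rfl⟩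

lemma componentRestrict_eq_one_of_tangentHom (g : G)
    (hg : (tangentHom hU).comp (Subgroup.inclusion hGL) g = 1) (n : ℕ) :
    componentRestrict hU hGL n g = 1 :=
  (componentRestrict_eq_one_iff hU hGL n g).2 fun u hu =>
    (dualHom_eq_one_iff hU.stable (Subgroup.inclusion hGL g)).1 hg u hu.1

/-- An element of `G` that acts on `E` as a reflection acts on each `E_n` as a reflection or
trivially. -/
lemma componentRestrict_of_isPseudoreflection [FiniteDimensional K V] [Finite G]
    [FiniteDimensional K U] (g : G)
    (hg : IsPseudoreflection (tangentHom hU (Subgroup.inclusion hGL g))) (n : ℕ) :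
    componentRestrict hU hGL n g = 1 ∨
      (IsPseudoreflection (componentHom hU n (Subgroup.inclusion hGL g)) ∧
        (U ⊓ homog K V n).map ((polyAct (g⁻¹ : V ≃ₗ[K] V)).toLinearMap - LinearMap.id) =
          U.map ((polyAct (g⁻¹ : V ≃ₗ[K] V)).toLinearMap - LinearMap.id)) := by
  have h1 : Module.finrank K
      (U.map ((polyAct (g⁻¹ : V ≃ₗ[K] V)).toLinearMap - LinearMap.id)) = 1 :=
    (finrank_quotient_ker_dualHom hU.stable (Subgroup.inclusion hGL g)).symm.trans hg.2
  have hle : (U ⊓ homog K V n).map ((polyAct (g⁻¹ : V ≃ₗ[K] V)).toLinearMap - LinearMap.id) ≤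
      U.map ((polyAct (g⁻¹ : V ≃ₗ[K] V)).toLinearMap - LinearMap.id) :=
    Submodule.map_mono inf_le_left
  by_cases hbot :
      (U ⊓ homog K V n).map ((polyAct (g⁻¹ : V ≃ₗ[K] V)).toLinearMap - LinearMap.id) = ⊥
  · left
    rw [← inv_eq_one, ← map_inv, componentRestrict_eq_one_iff]
    intro u hu
    have h2 := (Submodule.eq_bot_iff _).1 hbot _ ⟨u, hu, rfl⟩
    exact sub_eq_zero.1 h2
  · right
    -- The image of `g⁻¹ - 1` on all of `U` is a line; a nonzero image on one component must fill
    -- it.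
    have heq := Submodule.eq_of_le_of_finrank_le hle (by
      rw [h1]
      exact Submodule.one_le_finrank_iff.2 hbot)
    refine ⟨⟨?_, ?_⟩, heq⟩
    · exact ((componentHom hU n).comp (Subgroup.inclusion hGL)).isOfFinOrder
        (isOfFinOrder_of_finite g)
    · rw [← h1, ← heq]
      exact finrank_quotient_ker_dualHom _ _

variable [FiniteDimensional K V]

/-- The image of `G` in each `GL(E_n)` is a reflection group. -/
lemma isReflectionGroup_componentImage
    (hGL : G ≤ Subgroup.normalizer (L : Set (V ≃ₗ[K] V))) [Finite G] [FiniteDimensional K U]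
    (hrefl : IsReflectionGroup (tangentImage hU G)) (n : ℕ) :
    IsReflectionGroup (componentImage hU n G) := by
  have hfin : Finite (componentImage hU n G) :=
    Finite.of_surjective _ (componentRestrict_surjective hU hGL n)
  refine ⟨hfin, ?_⟩
  have h2 := hrefl.2
  rw [← range_tangentHom_comp hU hGL] at h2
  rw [← range_componentHom_comp hU hGL]
  refine closure_range_eq _ IsPseudoreflection h2 _ _ (fun g hg => ?_) fun g hg => ?_
  · exact congrArg Subtype.val (componentRestrict_eq_one_of_tangentHom hU hGL g hg n)
  · rcases componentRestrict_of_isPseudoreflection hU hGL g hg n with h3 | h3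
    · exact Or.inl (congrArg Subtype.val h3)
    · exact Or.inr h3.1

/-- The image of `G` in `GL(E)` is the product of its images in the groups `GL(E_n)`. -/
lemma componentsHom_surjective [CharZero K] [Finite G] [FiniteDimensional K U]
    (hrefl : IsReflectionGroup (tangentImage hU G)) (D : Finset ℕ) :
    Function.Surjective (componentsHom hU hGL D) := by
  have h2 := hrefl.2
  rw [← range_tangentHom_comp hU hGL] at h2
  refine pi_surjective_of_closure _ IsPseudoreflection h2 _
    (fun n => componentRestrict_surjective hU hGL n)
    (fun g hg n => componentRestrict_eq_one_of_tangentHom hU hGL g hg n) fun g hg m n hmn => ?_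
  by_contra! h
  have h4 := (componentRestrict_of_isPseudoreflection hU hGL g hg m).resolve_left h.1
  have h3 := (componentRestrict_of_isPseudoreflection hU hGL g hg n).resolve_left h.2
  have h5 : ∀ k : ℕ, (U ⊓ homog K V k).map
      ((polyAct (g⁻¹ : V ≃ₗ[K] V)).toLinearMap - LinearMap.id) ≤ homog K V k := by
    rintro k _ ⟨u, hu, rfl⟩
    exact sub_mem (polyAct_mem_homog _ k hu.2) hu.2
  -- Nontrivial action on two components would place the same line in two different degrees.
  have h6 : U.map ((polyAct (g⁻¹ : V ≃ₗ[K] V)).toLinearMap - LinearMap.id) ≤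
      homog K V (m : ℕ) ⊓ homog K V (n : ℕ) :=
    le_inf (h4.2 ▸ h5 m) (h3.2 ▸ h5 n)
  rw [disjoint_homog fun h => hmn (Subtype.ext h), le_bot_iff] at h6
  have h7 : Module.finrank K
      (U.map ((polyAct (g⁻¹ : V ≃ₗ[K] V)).toLinearMap - LinearMap.id)) = 1 :=
    (finrank_quotient_ker_dualHom hU.stable (Subgroup.inclusion hGL g)).symm.trans hg.2
  rw [h6, finrank_bot] at h7
  exact zero_ne_one h7

end Components

/-! ### Homomorphisms out of tensor products of algebras -/

section TensorAlgebras

variable {K ι R : Type*} [Field K] [Fintype ι] [CommRing R] [Algebra K R] {C : ι → Type*}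
  [∀ i, CommRing (C i)] [∀ i, Algebra K (C i)] (f : ∀ i, C i →ₐ[K] R)

/-- The algebra homomorphism from a tensor product of algebras defined by homomorphisms to a
commutative algebra. -/
def piTensorLift : (⨂[K] i, C i) →ₐ[K] R :=
  PiTensorProduct.liftAlgHom
    ((MultilinearMap.mkPiAlgebra K ι R).compLinearMap fun i => (f i).toLinearMap)
    (by simp) (fun x y => by simp [Finset.prod_mul_distrib])

lemma piTensorLift_tprod (x : ∀ i, C i) :
    piTensorLift f (PiTensorProduct.tprod K x) = ∏ i, f i (x i) := by
  change PiTensorProduct.lift _ (PiTensorProduct.tprod K x) = _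
  rw [PiTensorProduct.lift.tprod]
  rfl

lemma apply_mem_range_piTensorLift (i : ι) (x : C i) : f i x ∈ (piTensorLift f).range := by
  classical
  refine ⟨PiTensorProduct.tprod K (Pi.mulSingle i x), ?_⟩
  change piTensorLift f _ = _
  rw [piTensorLift_tprod, Finset.prod_eq_single i]
  · rw [Pi.mulSingle_eq_same]
  · intro j _ hj
    rw [Pi.mulSingle_eq_of_ne hj, map_one]
  · exact fun h => absurd (Finset.mem_univ _) h

lemma range_piTensorLift_le {B : Subalgebra K R} (h : ∀ i x, f i x ∈ B) :
    (piTensorLift f).range ≤ B := by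
  have key : ∀ x, piTensorLift f x ∈ B := by
    intro x
    induction x using PiTensorProduct.induction_on with
    | smul_tprod r x =>
      rw [map_smul, piTensorLift_tprod]
      exact Subalgebra.smul_mem _ (prod_mem fun i _ => h i (x i)) r
    | add x y hx hy => rw [map_add]; exact add_mem hx hy
  rintro _ ⟨x, rfl⟩
  exact key x

lemma piTensorLift_map (g : R →ₐ[K] R) (τ : ∀ i, C i →ₐ[K] C i)
    (h : ∀ i x, f i (τ i x) = g (f i x)) :
    g.toLinearMap ∘ₗ (piTensorLift f).toLinearMap =
      (piTensorLift f).toLinearMap ∘ₗ PiTensorProduct.map fun i => (τ i).toLinearMap := by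
  refine PiTensorProduct.ext (MultilinearMap.ext fun x => ?_)
  simp only [LinearMap.compMultilinearMap_apply, LinearMap.comp_apply, AlgHom.toLinearMap_apply,
    PiTensorProduct.map_tprod, piTensorLift_tprod, map_prod, h]

lemma finrank_piTensorProduct {C : ι → Type*} [∀ i, AddCommGroup (C i)] [∀ i, Module K (C i)]
    [∀ i, FiniteDimensional K (C i)] :
    Module.finrank K (⨂[K] i, C i) = ∏ i, Module.finrank K (C i) := by
  classical
  rw [Module.finrank_eq_card_basis (Basis.piTensorProduct fun i => Module.finBasis K (C i)),
    Fintype.card_pi]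
  simp

end TensorAlgebras

/-! ### Polynomial functions on the dual of a space of functions -/

section DualFunctions

variable {K : Type u} [Field K] {V : Type v} [AddCommGroup V] [Module K V]
  {A : Subgroup (V ≃ₗ[K] V)} {W : Submodule K (PolyFun K V)} [FiniteDimensional K W]

variable (W) in
/-- The algebra homomorphism from the polynomial functions on `W^*` to those on `V` that extends
the inclusion of `W`. -/
def dualPoly : PolyFun K (DualSpace W) →ₐ[K] PolyFun K V :=
  SymmetricAlgebra.lift (W.subtype ∘ₗ (Module.evalEquiv K W).symm.toLinearMap)

lemma dualPoly_ι_eval (u : W) :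
    dualPoly W (SymmetricAlgebra.ι K _ (Module.evalEquiv K W u)) = u := by
  rw [dualPoly, SymmetricAlgebra.lift_ι_apply, LinearMap.comp_apply, LinearEquiv.coe_coe,
    LinearEquiv.symm_apply_apply]
  rfl

/-- Linear forms on `W^*` are elements of `W`, and dualising the action twice returns the original
one; multiplicativity does the rest. -/
lemma dualPoly_polyAct (hW : ∀ g ∈ A, ∀ f ∈ W, polyAct g f ∈ W) (g : A)
    (f : PolyFun K (DualSpace W)) :
    dualPoly W (polyAct (dualHom A W hW g) f) = polyAct (g : V ≃ₗ[K] V) (dualPoly W f) := by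
  have hι : ∀ u : W, dualPoly W (polyAct (dualHom A W hW g)
      (SymmetricAlgebra.ι K _ (Module.evalEquiv K W u))) = polyAct (g : V ≃ₗ[K] V) u := by
    intro u
    have h : Module.evalEquiv K W u ∘ₗ ((dualHom A W hW g)⁻¹ :
        DualSpace W ≃ₗ[K] DualSpace W).toLinearMap =
        Module.evalEquiv K W ⟨polyAct (g : V ≃ₗ[K] V) u, hW g g.2 u u.2⟩ := by
      rw [← map_inv]
      refine LinearMap.ext fun φ => ?_
      change dualHom A W hW g⁻¹ φ u = φ _
      rw [dualHom_apply]
      simp only [inv_inv]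
    rw [polyAct_ι, h, dualPoly_ι_eval]
  induction f using SymmetricAlgebra.induction with
  | algebraMap r => simp only [AlgHom.commutes]
  | ι ξ =>
    obtain ⟨u, rfl⟩ := (Module.evalEquiv K W).surjective ξ
    rw [hι, dualPoly_ι_eval]
  | mul a b ha hb => simp only [map_mul, ha, hb]
  | add a b ha hb => simp only [map_add, ha, hb]

lemma algebraMapInv_dualPoly (hW : W ≤ posPart K V) (f : PolyFun K (DualSpace W)) :
    SymmetricAlgebra.algebraMapInv (dualPoly W f) = SymmetricAlgebra.algebraMapInv f := by
  suffices h : (SymmetricAlgebra.algebraMapInv (R := K)).comp (dualPoly W) =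
      SymmetricAlgebra.algebraMapInv from DFunLike.congr_fun h f
  apply SymmetricAlgebra.algHom_ext
  refine LinearMap.ext fun ξ => ?_
  obtain ⟨u, rfl⟩ := (Module.evalEquiv K W).surjective ξ
  change SymmetricAlgebra.algebraMapInv
    (dualPoly W (SymmetricAlgebra.ι K _ (Module.evalEquiv K W u))) =
    SymmetricAlgebra.algebraMapInv (SymmetricAlgebra.ι K _ (Module.evalEquiv K W u))
  rw [dualPoly_ι_eval, SymmetricAlgebra.algebraMapInv_ι]
  exact hW u.2

end DualFunctions

/-! ### Comparison of the coinvariant algebras -/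

section ComponentMaps

variable {K : Type u} [Field K] {V : Type v} [AddCommGroup V] [Module K V]
  {G L : Subgroup (V ≃ₗ[K] V)} {U : Submodule K (PolyFun K V)}

lemma IsStableComplement.le_invariantsPos (hU : IsStableComplement L U) : U ≤ invariantsPos L := by
  conv_rhs => rw [← hU.span]
  exact le_sup_left

/-- `S^L_+` is contained in the sum of the algebra generated by `U` and of any power of
`S^L_+`. -/
lemma IsStableComplement.invariantsPos_le (hU : IsStableComplement L U) (k : ℕ) :
    invariantsPos L ≤
      Subalgebra.toSubmodule (Algebra.adjoin K (U : Set (PolyFun K V))) ⊔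
        invariantsPos L ^ (k + 1) := by
  set P := invariantsPos L
  set B := Subalgebra.toSubmodule (Algebra.adjoin K (U : Set (PolyFun K V)))
  have hUP : U ≤ P := hU.le_invariantsPos
  have hUB : U ≤ B := Algebra.subset_adjoin
  have hBB : B * B ≤ B := Submodule.mul_le.2 fun a ha b hb =>
    (Algebra.adjoin K (U : Set (PolyFun K V))).mul_mem ha hb
  have step : ∀ k, P ^ k ≤ B ⊔ P ^ (k + 1) := by
    intro k
    induction k with
    | zero =>
      rw [pow_zero]
      refine le_trans ?_ le_sup_left
      intro x hx
      obtain ⟨r, rfl⟩ := Submodule.mem_one.1 hx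
      exact (Algebra.adjoin K (U : Set (PolyFun K V))).algebraMap_mem r
    | succ k ih =>
      -- Modulo a higher power, one factor may be taken from `U`; by induction the remaining `P ^ k`
      -- lies in `B` up to `P ^ (k + 1)`.
      calc P ^ (k + 1) = P ^ k * (U ⊔ P * P) := by rw [hU.span, pow_succ]
        _ = P ^ k * U ⊔ P ^ (k + 1 + 1) := by
          rw [Submodule.mul_sup, pow_succ, pow_succ, mul_assoc]
        _ ≤ (B ⊔ P ^ (k + 1)) * U ⊔ P ^ (k + 1 + 1) := by gcongr
        _ = B * U ⊔ P ^ (k + 1) * U ⊔ P ^ (k + 1 + 1) := by rw [Submodule.sup_mul]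
        _ ≤ B * B ⊔ P ^ (k + 1) * P ⊔ P ^ (k + 1 + 1) := by gcongr
        _ ≤ B ⊔ P ^ (k + 1 + 1) := by
          rw [← pow_succ, sup_assoc, sup_idem]
          gcongr
  induction k with
  | zero => rw [zero_add, pow_one]; exact le_sup_right
  | succ k ih =>
    refine ih.trans (sup_le le_sup_left (step _))

variable (hU : IsStableComplement L U) (hGL : G ≤ Subgroup.normalizer (L : Set (V ≃ₗ[K] V)))

lemma componentHom_mem_normalizer (n : ℕ)
    (h : Subgroup.normalizer (L : Set (V ≃ₗ[K] V)))
    (hh : (h : V ≃ₗ[K] V) ∈ Subgroup.normalizer (G : Set (V ≃ₗ[K] V))) :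
    componentHom hU n h ∈ Subgroup.normalizer
      (componentImage hU n G : Set (Component U n ≃ₗ[K] Component U n)) :=
  componentImage_le_normalizer hU n (Γ := Subgroup.normalizer (G : Set (V ≃ₗ[K] V))) le_rfl
    ⟨h, Subgroup.mem_subgroupOf.2 hh, rfl⟩

/-- The elements of `G` that act trivially on all `E_n`, `n ∈ D`. -/
def componentsKernel (hU : IsStableComplement L U)
    (hGL : G ≤ Subgroup.normalizer (L : Set (V ≃ₗ[K] V))) (D : Finset ℕ) :
    Subgroup (V ≃ₗ[K] V) :=
  (componentsHom hU hGL D).ker.map G.subtype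

lemma componentsKernel_le (D : Finset ℕ) : componentsKernel hU hGL D ≤ G := by
  rintro _ ⟨g, _, rfl⟩
  exact g.2

lemma componentHom_of_mem_componentsKernel (D : Finset ℕ) {x : V ≃ₗ[K] V}
    (hx : x ∈ componentsKernel hU hGL D) (n : D) :
    componentHom hU n ⟨x, hGL (componentsKernel_le hU hGL D hx)⟩ = 1 := by
  obtain ⟨g, hg, rfl⟩ := hx
  exact congrArg Subtype.val (congrFun (MonoidHom.mem_ker.1 hg) n)

lemma le_componentsKernel (hLG : L ≤ G) (D : Finset ℕ) : L ≤ componentsKernel hU hGL D := by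
  intro x hx
  refine ⟨⟨x, hLG hx⟩, MonoidHom.mem_ker.2 (funext fun n => ?_), rfl⟩
  exact (componentRestrict_eq_one_iff hU hGL n _).2 fun u hu =>
    (mem_invariantsPos.1 (hU.le_invariantsPos hu.1)).1 x hx

lemma mem_invariantAlgebra_componentsKernel (D : Finset ℕ) (n : D) {u : PolyFun K V}
    (hu : u ∈ U ⊓ homog K V n) : u ∈ invariantAlgebra (componentsKernel hU hGL D) := by
  rintro _ ⟨g, hg, rfl⟩
  exact (componentRestrict_eq_one_iff hU hGL n g).1 (congrFun (MonoidHom.mem_ker.1 hg) n) u hu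

lemma componentHom_mul_of_mem_componentsKernel (D : Finset ℕ) (n : D) {l : V ≃ₗ[K] V}
    (hl : l ∈ componentsKernel hU hGL D) (h : Subgroup.normalizer (L : Set (V ≃ₗ[K] V))) :
    componentHom hU n (⟨l, hGL (componentsKernel_le hU hGL D hl)⟩ * h) = componentHom hU n h := by
  rw [map_mul, componentHom_of_mem_componentsKernel hU hGL D hl n, one_mul]

lemma coinvariantsAct_congr {g g' : V ≃ₗ[K] V} (e : g = g')
    (hg : g ∈ Subgroup.normalizer (G : Set (V ≃ₗ[K] V)))
    (hg' : g' ∈ Subgroup.normalizer (G : Set (V ≃ₗ[K] V))) (x : Coinvariants G) :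
    coinvariantsAct hg x = coinvariantsAct hg' x := by
  subst e; rfl

lemma map_eq_map_of_inv_mul {A B : Type*} [Group A] [Group B] (f : A →* B) {a b : A}
    (h : f (a⁻¹ * b) = 1) : f a = f b := by
  rwa [map_mul, map_inv, inv_mul_eq_one] at h

/-- The components of `U` with degree in `D` lie in `S^N` and detect the action on the `E_n`.
Elements with distinct images in the product therefore act differently on `S^N`. -/
lemma componentsHom_eq_of_polyAct_eq (D : Finset ℕ) {a b : G}
    (h : ∀ f ∈ invariantAlgebra (componentsKernel hU hGL D),
      polyAct (a : V ≃ₗ[K] V) f = polyAct (b : V ≃ₗ[K] V) f) :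
    componentsHom hU hGL D a = componentsHom hU hGL D b := by
  funext n
  refine map_eq_map_of_inv_mul (componentRestrict hU hGL n) ?_
  refine (componentRestrict_eq_one_iff hU hGL n _).2 fun u hu => ?_
  rw [Subgroup.coe_mul, polyAct_mul_apply,
    ← h u (mem_invariantAlgebra_componentsKernel hU hGL D n hu), Subgroup.coe_inv,
    polyAct_inv_apply_self]

variable [FiniteDimensional K V]

lemma dualPoly_componentHom (n : ℕ) (g : Subgroup.normalizer (L : Set (V ≃ₗ[K] V)))
    (f : PolyFun K (Component U n)) :
    dualPoly (U ⊓ homog K V n) (polyAct (componentHom hU n g) f) =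
      polyAct (g : V ≃ₗ[K] V) (dualPoly (U ⊓ homog K V n) f) :=
  dualPoly_polyAct _ g f

lemma dualPoly_mem_invariantsPos (hGL : G ≤ Subgroup.normalizer (L : Set (V ≃ₗ[K] V)))
    (n : ℕ) {f : PolyFun K (Component U n)}
    (hf : f ∈ invariantsPos (componentImage hU n G)) :
    dualPoly (U ⊓ homog K V n) f ∈ invariantsPos G := by
  obtain ⟨h1, h2⟩ := mem_invariantsPos.1 hf
  refine mem_invariantsPos.2 ⟨fun g hg => ?_, ?_⟩
  · have h3 := dualPoly_componentHom hU n ⟨g, hGL hg⟩ f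
    rw [h1 _ ⟨_, Subgroup.mem_subgroupOf.2 hg, rfl⟩] at h3
    exact h3.symm
  · rw [algebraMapInv_dualPoly, h2]
    exact fun u hu => (hU.le_invariantsPos hu.1).2

/-- The homomorphism from the coinvariant algebra of the image of `G` in `GL(E_n)` to that
of `G`. -/
def componentMap (n : ℕ) : Coinvariants (componentImage hU n G) →ₐ[K] Coinvariants G :=
  Ideal.quotientMapₐ (coinvariantIdeal G) (dualPoly (U ⊓ homog K V n)) (by
    unfold coinvariantIdeal
    rw [Ideal.span_le]
    exact fun f hf => Ideal.subset_span (dualPoly_mem_invariantsPos hU hGL n hf))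

lemma componentMap_mk (n : ℕ) (f : PolyFun K (Component U n)) :
    componentMap hU hGL n (Ideal.Quotient.mk _ f) =
      Ideal.Quotient.mk _ (dualPoly (U ⊓ homog K V n) f) :=
  rfl

lemma componentMap_eval (n : ℕ) (u : (U ⊓ homog K V n : Submodule K (PolyFun K V))) :
    componentMap hU hGL n (Ideal.Quotient.mk _ (SymmetricAlgebra.ι K _ (Module.evalEquiv K _ u))) =
      Ideal.Quotient.mk _ (u : PolyFun K V) :=
  congrArg (Ideal.Quotient.mk (coinvariantIdeal G)) (dualPoly_ι_eval u)

lemma componentMap_coinvariantsAct (n : ℕ) (h : Subgroup.normalizer (L : Set (V ≃ₗ[K] V)))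
    (hh : (h : V ≃ₗ[K] V) ∈ Subgroup.normalizer (G : Set (V ≃ₗ[K] V)))
    (x : Coinvariants (componentImage hU n G)) :
    componentMap hU hGL n (coinvariantsAct (componentHom_mem_normalizer hU n h hh) x) =
      coinvariantsAct hh (componentMap hU hGL n x) := by
  obtain ⟨f, rfl⟩ := Ideal.Quotient.mk_surjective x
  exact congrArg (Ideal.Quotient.mk (coinvariantIdeal G)) (dualPoly_componentHom hU n h f)

/-- The kernel acts trivially on each `E_n`, so a single endomorphism of each tensor factor matches
every translate `l * h`. -/
lemma componentMap_coinvariantsAct_of_mem_componentsKernel (D : Finset ℕ) (n : D) {l : V ≃ₗ[K] V}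
    (hl : l ∈ componentsKernel hU hGL D) (h : Subgroup.normalizer (L : Set (V ≃ₗ[K] V)))
    (hh : (h : V ≃ₗ[K] V) ∈ Subgroup.normalizer (G : Set (V ≃ₗ[K] V)))
    (hlh : l * h ∈ Subgroup.normalizer (G : Set (V ≃ₗ[K] V)))
    (x : Coinvariants (componentImage hU (n : ℕ) G)) :
    componentMap hU hGL n (coinvariantsAct (componentHom_mem_normalizer hU n h hh) x) =
      coinvariantsAct hlh (componentMap hU hGL n x) := by
  have e := componentHom_mul_of_mem_componentsKernel hU hGL D n hl h
  have h1 := componentMap_coinvariantsAct hU hGL n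
    (⟨l, hGL (componentsKernel_le hU hGL D hl)⟩ * h) hlh x
  exact (congrArg (componentMap hU hGL n) (coinvariantsAct_congr e.symm _ _ x)).trans h1

/-- The homomorphism from the tensor product of the coinvariant algebras of the images of `G` in
the groups `GL(E_n)`, `n ∈ D`, to the coinvariant algebra of `G`. -/
def tensorComponentMap (D : Finset ℕ) :
    (⨂[K] n : D, Coinvariants (componentImage hU (n : ℕ) G)) →ₐ[K] Coinvariants G :=
  piTensorLift fun n => componentMap hU hGL n

lemma dualPoly_mem_invariantAlgebra (D : Finset ℕ) (n : D) (f : PolyFun K (Component U n)) :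
    dualPoly (U ⊓ homog K V n) f ∈ invariantAlgebra (componentsKernel hU hGL D) := by
  intro x hx
  rw [← dualPoly_componentHom hU n ⟨x, hGL (componentsKernel_le hU hGL D hx)⟩,
    componentHom_of_mem_componentsKernel hU hGL D hx n, polyAct_one_apply]

/-- The image of `tensorComponentMap` consists of classes of invariant functions. -/
lemma exists_invariant_of_mem_range (D : Finset ℕ) {y : Coinvariants G}
    (hy : y ∈ (tensorComponentMap hU hGL D).range) :
    ∃ f ∈ invariantAlgebra (componentsKernel hU hGL D),
      Ideal.Quotient.mk (coinvariantIdeal G) f = y := by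
  suffices h : (tensorComponentMap hU hGL D).range ≤
      (invariantAlgebra (componentsKernel hU hGL D)).map
        (Ideal.Quotient.mkₐ K (coinvariantIdeal G)) from h hy
  refine range_piTensorLift_le _ fun n x => ?_
  obtain ⟨f, rfl⟩ := Ideal.Quotient.mk_surjective x
  rw [componentMap_mk]
  exact ⟨_, dualPoly_mem_invariantAlgebra hU hGL D n f, rfl⟩

/-- A subalgebra of the coinvariant algebra that contains the classes of the homogeneous elements
of `U` contains the classes of all `L`-invariants. -/
lemma IsStableComplement.mk_mem (hU : IsStableComplement L U) (G : Subgroup (V ≃ₗ[K] V)) [Finite G]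
    {B : Subalgebra K (Coinvariants G)}
    (hB : ∀ n, ∀ u ∈ U ⊓ homog K V n, Ideal.Quotient.mk (coinvariantIdeal G) u ∈ B)
    {f : PolyFun K V} (hf : f ∈ invariantAlgebra L) :
    Ideal.Quotient.mk (coinvariantIdeal G) f ∈ B := by
  have hadj : Algebra.adjoin K (U : Set (PolyFun K V)) ≤
      B.comap (Ideal.Quotient.mkₐ K (coinvariantIdeal G)) := by
    refine Algebra.adjoin_le fun u hu => ?_
    have h1 : U ≤ Subalgebra.toSubmodule (B.comap (Ideal.Quotient.mkₐ K (coinvariantIdeal G))) :=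
      hU.graded.le.trans (iSup_le hB)
    exact h1 hu
  obtain ⟨k, hk⟩ := exists_posPart_pow_le G
  -- The remainder in `invariantsPos_le` dies in `S_G` for large exponents, so the algebra generated
  -- by `U` reaches every class of an `L`-invariant.
  have hk' : invariantsPos L ^ (k + 1) ≤ (coinvariantIdeal G).restrictScalars K := by
    refine le_trans (pow_le_pow_left' (inf_le_right : invariantsPos L ≤ posPart K V) _) ?_
    rw [pow_succ]
    refine Submodule.mul_le.2 fun a ha b _ => ?_
    exact Ideal.mul_mem_right _ _ (hk ha)
  have hfL : f - algebraMap K _ (SymmetricAlgebra.algebraMapInv f) ∈ invariantsPos L := by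
    refine mem_invariantsPos.2 ⟨sub_mem hf (Subalgebra.algebraMap_mem _ _), ?_⟩
    rw [map_sub, AlgHom.commutes]
    simp
  obtain ⟨b, hb, p, hp, hbp⟩ := Submodule.mem_sup.1 (hU.invariantsPos_le k hfL)
  have h1 : f = algebraMap K _ (SymmetricAlgebra.algebraMapInv f) + b + p := by
    rw [add_assoc, hbp]; ring
  have h2 : Ideal.Quotient.mk (coinvariantIdeal G) p = 0 :=
    Ideal.Quotient.eq_zero_iff_mem.2 (hk' hp)
  rw [h1, map_add, h2, add_zero]
  exact hadj (add_mem (Subalgebra.algebraMap_mem _ _) hb)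

/-- The image of `tensorComponentMap` contains the classes of all invariant functions. -/
lemma mk_mem_range [Finite G] (hLG : L ≤ G) (D : Finset ℕ)
    (hD : ∀ n, n ∉ D → U ⊓ homog K V n = ⊥) {f : PolyFun K V}
    (hf : f ∈ invariantAlgebra (componentsKernel hU hGL D)) :
    Ideal.Quotient.mk (coinvariantIdeal G) f ∈ (tensorComponentMap hU hGL D).range := by
  refine hU.mk_mem G (fun n u hu => ?_) fun x hx => hf x (le_componentsKernel hU hGL hLG D hx)
  by_cases hn : n ∈ D
  · exact componentMap_eval hU hGL n ⟨u, hu⟩ ▸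
      apply_mem_range_piTensorLift (fun n : D => componentMap hU hGL (n : ℕ)) ⟨n, hn⟩ _
  · rw [hD n hn, Submodule.mem_bot] at hu
    rw [hu, map_zero]
    exact zero_mem _

end ComponentMaps

/-! ### The tensor product decomposition and its traces -/

section Main

variable {K : Type u} [Field K]

lemma injective_of_finrank_le {X Y : Type*} [AddCommGroup X] [Module K X] [FiniteDimensional K X]
    [AddCommGroup Y] [Module K Y] (Φ : X →ₗ[K] Y)
    (h : Module.finrank K X ≤ Module.finrank K (LinearMap.range Φ)) : Function.Injective Φ := by
  have h1 := Φ.finrank_range_add_finrank_ker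
  have h2 : Module.finrank K (LinearMap.ker Φ) = 0 := by omega
  exact LinearMap.ker_eq_bot.1 (Submodule.finrank_eq_zero.1 h2)

lemma piTensorLift_injective {ι R : Type*} [Fintype ι] [CommRing R] [Algebra K R]
    {C : ι → Type*} [∀ i, CommRing (C i)] [∀ i, Algebra K (C i)] [∀ i, FiniteDimensional K (C i)]
    (f : ∀ i, C i →ₐ[K] R) (c : ι → ℕ) (hc : ∀ i, Module.finrank K (C i) ≤ c i)
    (h : ∏ i, c i ≤ Module.finrank K (LinearMap.range (piTensorLift f).toLinearMap)) :
    Function.Injective (piTensorLift f) := by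
  refine injective_of_finrank_le (piTensorLift f).toLinearMap (le_trans ?_ h)
  rw [finrank_piTensorProduct]
  exact Finset.prod_le_prod' fun i _ => hc i

/-- The average of the `g l` has image in the embedded tensor product and restricts to the tensor
product of the `τ i` there. Its trace is therefore the product of theirs. -/
lemma sum_trace_eq_of_piTensorLift [CharZero K] {ι N R : Type*} [Fintype ι] [Fintype N] [Nonempty N]
    [CommRing R] [Algebra K R] [FiniteDimensional K R] {C : ι → Type*} [∀ i, CommRing (C i)]
    [∀ i, Algebra K (C i)] [∀ i, FiniteDimensional K (C i)]
    (f : ∀ i, C i →ₐ[K] R) (hf : Function.Injective (piTensorLift f)) (g : N → R →ₐ[K] R)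
    (τ : ∀ i, C i →ₐ[K] C i) (h : ∀ l i x, f i (τ i x) = g l (f i x))
    (hr : ∀ y, ∑ l, g l y ∈ (piTensorLift f).range) :
    ∑ l, LinearMap.trace K R (g l).toLinearMap =
      Fintype.card N * ∏ i, LinearMap.trace K (C i) (τ i).toLinearMap := by
  have hcard : (Fintype.card N : K) ≠ 0 := Nat.cast_ne_zero.2 Fintype.card_ne_zero
  let T : R →ₗ[K] R := (Fintype.card N : K)⁻¹ • ∑ l : N, (g l).toLinearMap
  have hT : ∀ y, T y = (Fintype.card N : K)⁻¹ • ∑ l, g l y := fun y => by simp [T]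
  have hint : T ∘ₗ (piTensorLift f).toLinearMap =
      (piTensorLift f).toLinearMap ∘ₗ PiTensorProduct.map fun i => (τ i).toLinearMap := by
    refine LinearMap.ext fun x => ?_
    have h2 := fun l : N => DFunLike.congr_fun (piTensorLift_map f (g l) τ (h l)) x
    simp only [LinearMap.comp_apply, AlgHom.toLinearMap_apply] at h2
    simp only [LinearMap.comp_apply, AlgHom.toLinearMap_apply]
    rw [hT, Finset.sum_congr rfl fun l _ => h2 l, Finset.sum_const, Finset.card_univ,
      ← Nat.cast_smul_eq_nsmul K, smul_smul, inv_mul_cancel₀ hcard, one_smul]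
  have htr := trace_eq_of_intertwine (piTensorLift f).toLinearMap hf _ T hint fun y => by
    rw [hT]
    exact Submodule.smul_mem _ _ (hr y)
  rw [trace_piTensorProduct_map] at htr
  rw [← htr]
  simp only [T, map_smul, map_sum, smul_eq_mul]
  rw [← mul_assoc, mul_inv_cancel₀ hcard, one_mul]

variable [CharZero K] {V : Type v} [AddCommGroup V] [Module K V]
  [FiniteDimensional K V] {G L : Subgroup (V ≃ₗ[K] V)} {U : Submodule K (PolyFun K V)}
  (hU : IsStableComplement L U) (hGL : G ≤ Subgroup.normalizer (L : Set (V ≃ₗ[K] V)))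

/-- If elements of `G` induce distinct maps on the `N`-invariants, their number is at most the
dimension of any space of classes in `S_G` that consists of the classes of the `N`-invariants. -/
lemma card_le_finrank_of_invariants {N G : Subgroup (V ≃ₗ[K] V)} [Finite G] (hN : N ≤ G)
    {X : Type*} [Fintype X] (g : X → (V ≃ₗ[K] V)) (hg : ∀ x, g x ∈ G)
    (hinj : ∀ x y, (∀ f ∈ invariantAlgebra N, polyAct (g x) f = polyAct (g y) f) → x = y)
    (Q : Submodule K (Coinvariants G))
    (h1 : ∀ y ∈ Q, ∃ f ∈ invariantAlgebra N, Ideal.Quotient.mk (coinvariantIdeal G) f = y)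
    (h2 : ∀ f ∈ invariantAlgebra N, Ideal.Quotient.mk (coinvariantIdeal G) f ∈ Q) :
    Fintype.card X ≤ Module.finrank K Q := by
  let b := Module.finBasis K Q
  choose p hp hpb using fun i => h1 (b i) (b i).2
  rw [← Fintype.card_fin (Module.finrank K Q)]
  refine card_le_of_span_coinvariants hN g hg hinj p hp fun f hf => ?_
  refine ⟨fun i => b.repr ⟨_, h2 f hf⟩ i, ?_⟩
  have h3 := congrArg Subtype.val (b.sum_repr ⟨_, h2 f hf⟩)
  rw [AddSubmonoidClass.coe_finsetSum] at h3
  rw [← Ideal.Quotient.eq_zero_iff_mem, map_sub, sub_eq_zero]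
  refine h3.symm.trans ?_
  rw [map_sum]
  refine Finset.sum_congr rfl fun i _ => ?_
  rw [Submodule.coe_smul, ← hpb i]
  rfl

set_option maxHeartbeats 2000000 in
-- Two opposite bounds meet: by Chevalley the source has dimension at most `∏ |Ḡ_n|`, while its
-- image, consisting of the classes of `S^N`, has dimension at least `|G/N| = ∏ |Ḡ_n|`.
lemma tensorComponentMap_injective [Finite G] [FiniteDimensional K U] (hLG : L ≤ G)
    (hrefl : IsReflectionGroup (tangentImage hU G)) (D : Finset ℕ)
    (hD : ∀ n, n ∉ D → U ⊓ homog K V n = ⊥) :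
    Function.Injective (tensorComponentMap hU hGL D) := by
  classical
  have hW := isReflectionGroup_componentImage hU hGL hrefl
  have hfin : ∀ n : D, Finite (componentImage hU (n : ℕ) G) := fun n => (hW n).1
  have hfin' : ∀ n : D, Fintype (componentImage hU (n : ℕ) G) := fun n => Fintype.ofFinite _
  -- A section of `G → ∏ Ḡ_n` provides coset representatives of `N`, indexed by the product group.
  choose s hs using componentsHom_surjective hU hGL hrefl D
  have h1 := card_le_finrank_of_invariants (componentsKernel_le hU hGL D) (fun x => (s x).1)
    (fun x => (s x).2)
    (fun x y hxy => (hs x).symm.trans ((componentsHom_eq_of_polyAct_eq hU hGL D hxy).trans (hs y)))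
    (LinearMap.range (tensorComponentMap hU hGL D).toLinearMap)
    (fun y hy => exists_invariant_of_mem_range hU hGL D hy)
    (fun f hf => mk_mem_range hU hGL hLG D hD hf)
  rw [Fintype.card_pi] at h1
  refine piTensorLift_injective (fun n : D => componentMap hU hGL (n : ℕ))
    (fun n => Fintype.card (componentImage hU (n : ℕ) G)) (fun n => ?_) h1
  rw [← Nat.card_eq_fintype_card]
  exact (hW n).finrank_coinvariants_le

set_option maxHeartbeats 2000000 in
/-- The average over the kernel of `G → ∏ GL(E_n)` of traces on the coinvariant algebra is the
product of the traces on the coinvariant algebras of the images of `G`. -/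
lemma sum_coinvariantTrace [Finite G] [FiniteDimensional K U] (hLG : L ≤ G)
    (hrefl : IsReflectionGroup (tangentImage hU G)) (D : Finset ℕ)
    (hD : ∀ n, n ∉ D → U ⊓ homog K V n = ⊥) [Fintype (componentsKernel hU hGL D)]
    (h : Subgroup.normalizer (L : Set (V ≃ₗ[K] V)))
    (hh : (h : V ≃ₗ[K] V) ∈ Subgroup.normalizer (G : Set (V ≃ₗ[K] V))) :
    ∑ l : componentsKernel hU hGL D, coinvariantTrace G (l * h) =
      Fintype.card (componentsKernel hU hGL D) *
        ∏ n : D, coinvariantTrace (componentImage hU (n : ℕ) G) (componentHom hU n h) := by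
  have hW := isReflectionGroup_componentImage hU hGL hrefl
  have hfin : ∀ n : D, Finite (componentImage hU (n : ℕ) G) := fun n => (hW n).1
  have hNG := componentsKernel_le hU hGL D
  have hmem : ∀ l : componentsKernel hU hGL D,
      (l : V ≃ₗ[K] V) * h ∈ Subgroup.normalizer (G : Set (V ≃ₗ[K] V)) :=
    fun l => mul_mem (Subgroup.le_normalizer (hNG l.2)) hh
  rw [Finset.prod_congr rfl fun (n : D) _ =>
      coinvariantTrace_eq (componentHom_mem_normalizer hU n h hh),
    Finset.sum_congr rfl fun l _ => coinvariantTrace_eq (hmem l)]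
  refine sum_trace_eq_of_piTensorLift _ (tensorComponentMap_injective hU hGL hLG hrefl D hD)
    (fun l => coinvariantsAct (hmem l))
    (fun n => coinvariantsAct (componentHom_mem_normalizer hU n h hh))
    (fun l n x => componentMap_coinvariantsAct_of_mem_componentsKernel hU hGL D n l.2 h hh
      (hmem l) x) fun y => ?_
  -- The sum over `N` of the translates of a class is represented by an `N`-invariant function,
  -- hence lies in the range.
  obtain ⟨f, rfl⟩ := Ideal.Quotient.mk_surjective y
  have h1 := mk_mem_range hU hGL hLG D hD
    (sum_polyAct_mem (componentsKernel hU hGL D) (polyAct (h : V ≃ₗ[K] V) f))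
  rw [map_sum] at h1
  have h2 : ∀ l : componentsKernel hU hGL D,
      coinvariantsAct (hmem l) (Ideal.Quotient.mk (coinvariantIdeal G) f) =
        Ideal.Quotient.mk (coinvariantIdeal G) (polyAct (l : V ≃ₗ[K] V)
          (polyAct (h : V ≃ₗ[K] V) f)) := fun l => by
    rw [← polyAct_mul_apply, coinvariantsAct_mk]
  exact (Finset.sum_congr rfl fun l _ => h2 l) ▸ h1

end Main

/-! ### Averages over finite groups -/

section Averages

/-- Replacing `g` by `a l * g` permutes the terms and leaves `X` unchanged, so `F` may be replaced
by its average over `l`. -/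
lemma sum_mul_eq_of_average {K A N : Type*} [Field K] [CharZero K] [Group A] [Fintype A] [Fintype N]
    [Nonempty N] (a : N → A) (F P X : A → K) (hX : ∀ l g, X (a l * g) = X g)
    (hF : ∀ g, ∑ l, F (a l * g) = Fintype.card N * P g) :
    ∑ g, F g * X g = ∑ g, P g * X g := by
  have hcard : (Fintype.card N : K) ≠ 0 := Nat.cast_ne_zero.2 Fintype.card_ne_zero
  refine mul_left_cancel₀ hcard ?_
  have h1 : ∀ l, ∑ g, F g * X g = ∑ g, F (a l * g) * X g := fun l =>
    (Fintype.sum_equiv (Equiv.mulLeft (a l)) _ _ fun g => by rw [Equiv.coe_mulLeft, hX]).symm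
  calc (Fintype.card N : K) * ∑ g, F g * X g = ∑ l, ∑ g, F (a l * g) * X g := by
        rw [← Finset.sum_congr rfl fun l _ => h1 l, Finset.sum_const, Finset.card_univ,
          nsmul_eq_mul]
    _ = ∑ g, (Fintype.card N * P g) * X g := by
        rw [Finset.sum_comm]
        exact Finset.sum_congr rfl fun g _ => by rw [← Finset.sum_mul, hF]
    _ = _ := by
        rw [Finset.mul_sum]
        exact Finset.sum_congr rfl fun g _ => by ring

/-- All fibres of a surjective homomorphism have the same number of elements. -/
lemma average_comp_surjective {K A B : Type*} [Field K] [CharZero K] [Group A] [Group B] [Fintype A]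
    [Fintype B] (ψ : A →* B) (hψ : Function.Surjective ψ) (H : B → K) :
    (Fintype.card A : K)⁻¹ * ∑ a, H (ψ a) = (Fintype.card B : K)⁻¹ * ∑ b, H b := by
  classical
  set c := Finset.card {a | ψ a = 1}
  have hfib : ∀ b, Finset.card {a | ψ a = b} = c := fun b =>
    MonoidHom.card_fiber_eq_of_mem_range ψ (hψ b) (hψ 1)
  have h1 : ∑ a, H (ψ a) = c * ∑ b, H b := by
    rw [← Finset.sum_fiberwise Finset.univ ψ, Finset.mul_sum]
    refine Finset.sum_congr rfl fun b _ => ?_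
    rw [Finset.sum_congr rfl (g := fun _ => H b) fun a ha => by rw [(Finset.mem_filter.1 ha).2],
      Finset.sum_const, hfib, nsmul_eq_mul]
  have h2 : Fintype.card A = Fintype.card B * c := by
    rw [← Finset.card_univ, Finset.card_eq_sum_card_fiberwise (f := ψ) (t := Finset.univ)
      fun _ _ => Finset.mem_univ _, Finset.sum_congr rfl fun b _ => hfib b, Finset.sum_const,
      Finset.card_univ, smul_eq_mul]
  have hA : (Fintype.card A : K) ≠ 0 := Nat.cast_ne_zero.2 Fintype.card_ne_zero
  have h3 : (Fintype.card A : K) = Fintype.card B * c := by exact_mod_cast h2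
  have hB : (Fintype.card B : K) ≠ 0 := fun h => hA (by rw [h3, h, zero_mul])
  have hc : (c : K) ≠ 0 := fun h => hA (by rw [h3, h, mul_zero])
  rw [h1, h3]
  field_simp

lemma prod_average {K ι : Type*} [Field K] [Fintype ι] {B : ι → Type*} [DecidableEq ι]
    [∀ i, Fintype (B i)] (F : ∀ i, B i → K) :
    ∏ i, ((Fintype.card (B i) : K)⁻¹ * ∑ x, F i x) =
      (Fintype.card (∀ i, B i) : K)⁻¹ * ∑ x : ∀ i, B i, ∏ i, F i (x i) := by
  rw [Finset.prod_mul_distrib, Finset.prod_univ_sum, Fintype.piFinset_univ, Finset.prod_inv_distrib,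
    Fintype.card_pi, Nat.cast_prod]

end Averages

/-! ### Values of the fake degrees -/

section Evaluation

variable {K : Type u} [Field K] {V : Type v} [AddCommGroup V] [Module K V]
  {G L Γ : Subgroup (V ≃ₗ[K] V)} {U : Submodule K (PolyFun K V)}

lemma scaling_inv (t : Kˣ) : (scaling V t)⁻¹ = scaling V t⁻¹ := by
  ext x
  rw [scaling_inv_apply]
  change _ = ((t⁻¹)⁻¹ : Kˣ) • x
  rw [inv_inv]
  rfl

/-- The elements of `U` of degree `n` are the linear forms on `E_n`, and the homothety multiplies
them by `t^n`. This is the source of the substitution `t ↦ t^n`. -/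
lemma componentHom_scaling (hU : IsStableComplement L U) (n : ℕ) (t : Kˣ) :
    componentHom hU n ⟨scaling V t, scaling_mem_normalizer t L⟩ =
      scaling (Component U n) (t ^ n) := by
  refine LinearEquiv.ext fun φ => LinearMap.ext fun u => ?_
  have h1 : polyAct (scaling V t)⁻¹ (u : PolyFun K V) = ((t ^ n)⁻¹ : Kˣ) • (u : PolyFun K V) := by
    rw [scaling_inv, polyAct_scaling t⁻¹ n u.2.2, Units.smul_def, ← inv_pow,
      Units.val_pow_eq_pow_val]
  refine (congrArg φ (Subtype.ext h1 : _ = (((t ^ n)⁻¹ : Kˣ) : K) • u)).trans ?_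
  rw [map_smul]
  rfl

variable {M : ℕ → Type w} [∀ n, AddCommGroup (M n)] [∀ n, Module K (M n)]
  [∀ n, FiniteDimensional K (M n)]

lemma trace_tensorRep (hU : IsStableComplement L U)
    (hG : G ≤ Subgroup.normalizer (L : Set (V ≃ₗ[K] V)))
    (hΓ : Γ ≤ Subgroup.normalizer (L : Set (V ≃ₗ[K] V))) (D : Finset ℕ)
    (ρ : ∀ n, Representation K ↥(componentImage hU n G ⊔ componentImage hU n Γ) (M n))
    (a : ↥(G ⊔ Γ)) :
    LinearMap.trace K _ (tensorRep hU hG hΓ D ρ a) =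
      ∏ n : D, LinearMap.trace K (M n) (ρ n (toComponent hU hG hΓ n a)) :=
  trace_piTensorProduct_map fun n : D => ρ n (toComponent hU hG hΓ n a)

lemma eval_fakeDegree_comp [CharZero K] [FiniteDimensional K V] {A : Subgroup (V ≃ₗ[K] V)}
    [Fintype G] {M : Type w} [AddCommGroup M] [Module K M] [FiniteDimensional K M] (hGA : G ≤ A)
    (hA : A ≤ Subgroup.normalizer (G : Set (V ≃ₗ[K] V))) (ρ : Representation K A M) (γ : A)
    (t : Kˣ) (n : ℕ) :
    ((fakeDegree hGA hA ρ γ).comp (Polynomial.X ^ n)).eval (t : K) =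
      (Fintype.card G : K)⁻¹ * ∑ g : G, coinvariantTrace G (g * γ * scaling V (t ^ n)) *
        LinearMap.trace K M (ρ (Subgroup.inclusion hGA g * γ)⁻¹) := by
  rw [Polynomial.eval_comp, Polynomial.eval_pow, Polynomial.eval_X, ← Units.val_pow_eq_pow_val,
    eval_fakeDegree]

/-- The trace of `x γ`, scaled by `t`, on the coinvariant algebra of the image of `G`
in `GL(E_n)`. -/
def componentTrace (hU : IsStableComplement L U)
    (hG : G ≤ Subgroup.normalizer (L : Set (V ≃ₗ[K] V)))
    (hΓ : Γ ≤ Subgroup.normalizer (L : Set (V ≃ₗ[K] V))) (n : ℕ) (γ : ↥(G ⊔ Γ)) (t : Kˣ)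
    (x : componentImage hU n G) : K :=
  coinvariantTrace (componentImage hU n G)
    (x.1 * (toComponent hU hG hΓ n γ).1 * scaling _ (t ^ n))

/-- The trace of `(x γ)⁻¹` on `M`. -/
def componentChar (hU : IsStableComplement L U)
    (hG : G ≤ Subgroup.normalizer (L : Set (V ≃ₗ[K] V)))
    (hΓ : Γ ≤ Subgroup.normalizer (L : Set (V ≃ₗ[K] V))) (n : ℕ) (γ : ↥(G ⊔ Γ))
    {M : Type w} [AddCommGroup M] [Module K M]
    (ρ : Representation K ↥(componentImage hU n G ⊔ componentImage hU n Γ) M)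
    (x : componentImage hU n G) : K :=
  LinearMap.trace K M (ρ (Subgroup.inclusion le_sup_left x * toComponent hU hG hΓ n γ)⁻¹)

/-- The factor of index `n` of a value of the product of fake degrees. -/
lemma eval_fakeDegree_component [CharZero K] [FiniteDimensional K V] (hU : IsStableComplement L U)
    (hG : G ≤ Subgroup.normalizer (L : Set (V ≃ₗ[K] V)))
    (hΓ : Γ ≤ Subgroup.normalizer (L : Set (V ≃ₗ[K] V)))
    (hΓG : Γ ≤ Subgroup.normalizer (G : Set (V ≃ₗ[K] V)))
    (n : ℕ) [Fintype (componentImage hU n G)]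
    {M : Type w} [AddCommGroup M] [Module K M] [FiniteDimensional K M]
    (ρ : Representation K ↥(componentImage hU n G ⊔ componentImage hU n Γ) M)
    (γ : ↥(G ⊔ Γ)) (t : Kˣ) :
    Polynomial.eval (t : K) ((fakeDegree le_sup_left
      (sup_le_normalizer (componentImage_le_normalizer hU n hΓG)) ρ
        (toComponent hU hG hΓ n γ)).comp (Polynomial.X ^ n)) =
      (Fintype.card (componentImage hU n G) : K)⁻¹ * ∑ x : componentImage hU n G,
          componentTrace hU hG hΓ n γ t x * componentChar hU hG hΓ n γ ρ x :=
  eval_fakeDegree_comp _ _ ρ _ t n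

lemma map_inv_of_mul {A B : Type*} [Group A] [Group B] (f : A →* B) (a b : A) :
    f (a * b)⁻¹ = (f a * f b)⁻¹ := by
  rw [map_inv, map_mul]

lemma toComponent_inclusion (hU : IsStableComplement L U)
    (hG : G ≤ Subgroup.normalizer (L : Set (V ≃ₗ[K] V)))
    (hΓ : Γ ≤ Subgroup.normalizer (L : Set (V ≃ₗ[K] V))) (n : ℕ) (g : G) :
    toComponent hU hG hΓ n (Subgroup.inclusion le_sup_left g) =
      Subgroup.inclusion le_sup_left (componentRestrict hU hG n g) :=
  rfl

lemma componentChar_componentRestrict (hU : IsStableComplement L U)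
    (hG : G ≤ Subgroup.normalizer (L : Set (V ≃ₗ[K] V)))
    (hΓ : Γ ≤ Subgroup.normalizer (L : Set (V ≃ₗ[K] V))) (n : ℕ)
    {M : Type w} [AddCommGroup M] [Module K M]
    (ρ : Representation K ↥(componentImage hU n G ⊔ componentImage hU n Γ) M)
    (γ : ↥(G ⊔ Γ)) (g : G) :
    LinearMap.trace K M
        (ρ (toComponent hU hG hΓ n (Subgroup.inclusion le_sup_left g * γ)⁻¹)) =
      componentChar hU hG hΓ n γ ρ (componentRestrict hU hG n g) := by
  have h1 := map_inv_of_mul (toComponent hU hG hΓ n) (Subgroup.inclusion le_sup_left g) γ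
  exact (congrArg (fun y => LinearMap.trace K M (ρ y)) h1).trans
    (congrArg (fun y => LinearMap.trace K M (ρ (y * toComponent hU hG hΓ n γ)⁻¹))
      (toComponent_inclusion hU hG hΓ n g))

lemma map_eq_of_eq_mul {A B : Type*} [Group A] [Group B] (f : A →* B) {a b c d : A} {y : B}
    (h : d = a * b * c) (hy : f c = y) : f d = f a * f b * y := by
  rw [h, map_mul, map_mul, hy]

lemma componentTrace_componentRestrict (hU : IsStableComplement L U)
    (hG : G ≤ Subgroup.normalizer (L : Set (V ≃ₗ[K] V)))
    (hΓ : Γ ≤ Subgroup.normalizer (L : Set (V ≃ₗ[K] V))) (n : ℕ) (g : G) (γ : ↥(G ⊔ Γ)) (t : Kˣ)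
    (h : (g : V ≃ₗ[K] V) * γ.1 * scaling V t ∈ Subgroup.normalizer (L : Set (V ≃ₗ[K] V))) :
    coinvariantTrace (componentImage hU n G)
        (componentHom hU n ⟨(g : V ≃ₗ[K] V) * γ.1 * scaling V t, h⟩) =
      componentTrace hU hG hΓ n γ t (componentRestrict hU hG n g) := by
  have h1 := map_eq_of_eq_mul (componentHom hU n)
    (a := ⟨g, hG g.2⟩) (b := ⟨γ, sup_le hG hΓ γ.2⟩)
    (c := ⟨scaling V t, scaling_mem_normalizer t L⟩)
    (d := ⟨(g : V ≃ₗ[K] V) * γ.1 * scaling V t, h⟩) rfl (componentHom_scaling hU n t)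
  exact congrArg (coinvariantTrace _) h1

/-- The value of the fake degree of the tensor product as an average over `G`. -/
lemma eval_fakeDegree_tensorRep [CharZero K] [FiniteDimensional K V] [FiniteDimensional K U]
    [Fintype G] (hU : IsStableComplement L U) (hLG : L ≤ G)
    (hG : G ≤ Subgroup.normalizer (L : Set (V ≃ₗ[K] V)))
    (hΓ : Γ ≤ Subgroup.normalizer (L : Set (V ≃ₗ[K] V)))
    (hΓG : Γ ≤ Subgroup.normalizer (G : Set (V ≃ₗ[K] V)))
    (hrefl : IsReflectionGroup (tangentImage hU G)) (D : Finset ℕ)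
    (hD : ∀ n, n ∉ D → U ⊓ homog K V n = ⊥)
    (ρ : ∀ n, Representation K ↥(componentImage hU n G ⊔ componentImage hU n Γ) (M n))
    (γ : ↥(G ⊔ Γ)) (t : Kˣ) :
    Polynomial.eval (t : K) (fakeDegree le_sup_left (sup_le_normalizer hΓG)
      (tensorRep hU hG hΓ D ρ) γ) =
    (Fintype.card G : K)⁻¹ * ∑ g : G,
      ∏ n : D, componentTrace hU hG hΓ n γ t (componentRestrict hU hG n g) *
        componentChar hU hG hΓ n γ (ρ n) (componentRestrict hU hG n g) := by
  have hNG := componentsKernel_le hU hG D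
  have : Finite (componentsKernel hU hG D) :=
    Finite.of_injective _ (Subgroup.inclusion_injective hNG)
  have := Fintype.ofFinite (componentsKernel hU hG D)
  refine (eval_fakeDegree _ _ _ _ _).trans (congrArg _ ?_)
  refine (Finset.sum_congr rfl fun g _ =>
    congrArg (_ * ·) ((trace_tensorRep hU hG hΓ D ρ _).trans
      (Finset.prod_congr rfl fun n _ =>
        componentChar_componentRestrict hU hG hΓ n (ρ n) γ g))).trans ?_
  -- The character of `M` is constant on cosets of the kernel, so the trace on `S_G` may be replaced
  -- by its average over the kernel, which is a product over the components.
  refine (sum_mul_eq_of_average (Subgroup.inclusion hNG)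
    (fun g : G => coinvariantTrace G ((g : V ≃ₗ[K] V) * γ.1 * scaling V t))
    (fun g : G => ∏ n : D, componentTrace hU hG hΓ n γ t (componentRestrict hU hG n g))
    (fun g : G => ∏ n : D, componentChar hU hG hΓ n γ (ρ n) (componentRestrict hU hG n g))
    (fun l g => ?_) fun g => ?_).trans
    (Finset.sum_congr rfl fun g _ => Finset.prod_mul_distrib.symm)
  · refine Finset.prod_congr rfl fun n _ => congrArg _ ?_
    exact Subtype.ext (componentHom_mul_of_mem_componentsKernel hU hG D n l.2 ⟨g, hG g.2⟩)
  · have hL : (g : V ≃ₗ[K] V) * γ.1 * scaling V t ∈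
        Subgroup.normalizer (L : Set (V ≃ₗ[K] V)) :=
      mul_mem (mul_mem (hG g.2) (sup_le hG hΓ γ.2)) (scaling_mem_normalizer t L)
    have hGG : (g : V ≃ₗ[K] V) * γ.1 * scaling V t ∈
        Subgroup.normalizer (G : Set (V ≃ₗ[K] V)) :=
      mul_mem (mul_mem (Subgroup.le_normalizer g.2) (sup_le_normalizer hΓG γ.2))
        (scaling_mem_normalizer t G)
    have h1 := sum_coinvariantTrace hU hG hLG hrefl D hD ⟨_, hL⟩ hGG
    refine (Finset.sum_congr rfl fun l _ => ?_).trans (h1.trans (congrArg _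
      (Finset.prod_congr rfl fun n _ => componentTrace_componentRestrict hU hG hΓ n g γ t hL)))
    have h2 : ∀ a b c d : V ≃ₗ[K] V, a * b * c * d = a * (b * c * d) := fun a b c d => by
      simp only [mul_assoc]
    exact congrArg (coinvariantTrace G) (h2 l g γ (scaling V t))

end Evaluation

end

end ReflectionCoset

/-! ### The product formula -/

open ReflectionCoset
theorem mainTheorem12 {K : Type*} [Field K] [IsAlgClosed K] [CharZero K]
    {V : Type*} [AddCommGroup V] [Module K V] [FiniteDimensional K V]
    (G L Γ : Subgroup (V ≃ₗ[K] V)) (hG : IsReflectionGroup G) (hLG : L ≤ G)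
    (hGL : G ≤ Subgroup.normalizer (L : Set (V ≃ₗ[K] V)))
    (hΓG : Γ ≤ Subgroup.normalizer (G : Set (V ≃ₗ[K] V)))
    (hΓL : Γ ≤ Subgroup.normalizer (L : Set (V ≃ₗ[K] V)))
    (U : Submodule K (PolyFun K V)) (hU : IsStableComplement L U)
    (hrefl : IsReflectionGroup (tangentImage hU G))
    (D : Finset ℕ) (hD : ∀ n, n ∉ D → U ⊓ homog K V n = ⊥)
    (M : ℕ → Type*) [∀ n, AddCommGroup (M n)] [∀ n, Module K (M n)]
    [∀ n, FiniteDimensional K (M n)]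
    (ρ : ∀ n, Representation K ↥(componentImage hU n G ⊔ componentImage hU n Γ) (M n))
    (γ : V ≃ₗ[K] V) (hγ : γ ∈ Γ) :
    fakeDegree le_sup_left (sup_le_normalizer hΓG) (tensorRep hU hGL hΓL D ρ)
        ⟨γ, Subgroup.mem_sup_right hγ⟩ =
      ∏ n ∈ D,
        (fakeDegree le_sup_left (sup_le_normalizer (componentImage_le_normalizer hU n hΓG)) (ρ n)
          (toComponent hU hGL hΓL n ⟨γ, Subgroup.mem_sup_right hγ⟩)).comp (Polynomial.X ^ n) := by
  classical
  have := hG.1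
  have := Fintype.ofFinite G
  have hfd := hU.finiteDimensional D hD
  have hW := isReflectionGroup_componentImage hU hGL hrefl
  have hfin : ∀ n : ℕ, Fintype (componentImage hU n G) := fun n =>
    @Fintype.ofFinite _ (hW n).1
  -- It suffices to compare values at nonzero `t`, those for which the homothety is invertible;
  -- there are infinitely many in characteristic zero.
  refine Polynomial.eq_of_infinite_eval_eq _ _
    ((Set.finite_singleton (0 : K)).infinite_compl.mono fun t₀ ht₀ => ?_)
  obtain ⟨t, rfl⟩ : ∃ t : Kˣ, (t : K) = t₀ := ⟨Units.mk0 t₀ ht₀, rfl⟩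
  rw [Set.mem_ofPred_eq, Polynomial.eval_prod, ← Finset.prod_coe_sort]
  refine (eval_fakeDegree_tensorRep hU hLG hGL hΓL hΓG hrefl D hD ρ _ t).trans ?_
  refine Eq.trans ?_ (Finset.prod_congr rfl fun (n : D) _ =>
    eval_fakeDegree_component hU hGL hΓL hΓG n (ρ n) _ t).symm
  refine Eq.trans ?_ (prod_average _).symm
  -- The summand depends on `g` only through its image in `∏ Ḡ_n`, which `G` fills uniformly.
  exact average_comp_surjective _ (componentsHom_surjective hU hGL hrefl D)
    fun x => ∏ n : D, componentTrace hU hGL hΓL n _ t (x n) *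
      componentChar hU hGL hΓL n _ (ρ n) (x n)
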